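/- Let $n\ge 1$. A composition is an $n$-tuple $\eta=(\eta_1,\dots,\eta_n)$ of non-negative integers; put $s_i\eta=(\dots,\eta_{i+1},\eta_i,\dots)$ for $1\le i\le n-1$ and $\Phi\eta=(\eta_2,\dots,\eta_n,\eta_1+1)$. **The operator word.** Words in the letters $0,1,\dots,n-1$ encode sequences of operators, the letter $0$ standing for $\Phi$ and the letter $i\ge 1$ for $s_i$, and the leftmost letter is applied first. For a composition $\eta$ let $l_{\eta,i}=\#\{j:\eta_j<i\}$ and $g_{\eta,i}=\#\{j:\eta_j\ge i\}$, and with $l=l_{\eta,i-1}$, $g=g_{\eta,i}$ let $\sigma(\eta,i)=(l,\dots,1,\ l+1,\dots,2,\ \dots,\ l+g-1,\dots,g)$. Let $r_{\eta,1}=0^{g_{\eta,1}}$ and, for $i>1$, let $r_{\eta,i}$ be $\sigma(\eta,i)$ followed by $0^{g_{\eta,i}}$. Let $c$ be the weakly increasing rearrangement of $\eta$. For $i=n,n-1,\dots,2$ successively let $p_{\eta,i}=\max\{j\le i: c_j=\eta_i\}$, let $\sigma'(\eta,i)=(p_{\eta,i},\dots,i-1)$ (empty if $p_{\eta,i}=i$),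 and replace $c$ by the result of applying $\sigma'(\eta,i)$ to it. The word $R(\eta)$ is the concatenation $r_{\eta,1}\cdots r_{\eta,\max\eta}\,\sigma'(\eta,n)\cdots\sigma'(\eta,2)$. Let $\eta(j)$ be the composition obtained from $(0,\dots,0)$ by the first $j$ letters of $R(\eta)$. **The recursion.** Let $F=(F_\eta)$ be a family of polynomials in $z_1,\dots,z_n$ over a field $K$, indexed by the compositions, with $F_{(0,\dots,0)}=1$, for which formulas are known that compute $F_{s_i\nu}$ from $F_\nu$ (for each $\nu$ and $1\le i\le n-1$) and $F_{\Phi\nu}$ from $F_\nu$ (for each $\nu$). Start with the pair $(1,(0,\dots,0))$ and read $R(\eta)$ letter by letter; at a letter $i\ge1$ apply to the current pair $(f,\nu)$ the formula for $s_i$, giving a new polynomial and the label $s_i\nu$; at a letter $0$ apply the formula for $\Phi$, giving a new polynomial and the label $\Phi\nu$. **Claim.** For every $\eta$ all letters of $R(\eta)$ are among $0,\dots,n-1$ and $\eta(|R(\eta)|)=\eta$. For each $j\le|R(\eta)|$ the pair reached after $j$ steps is $(F_{\eta(j)},\eta(j))$; in particular after $|R(\eta)|$ steps it is $(F_\eta,\eta)$.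 **Macdonald polynomials.** Let $q,t\in K$ be nonzero with $q^at^b\ne1$ for all integers $a\ge1$ and $b$ (for example indeterminates $q,t$ and $K=\mathbb Q(q,t)$). Let $s_i$ act on polynomials by exchanging $z_i,z_{i+1}$, and put $$T_i=t+\tfrac{tz_i-z_{i+1}}{z_i-z_{i+1}}(s_i-1),\quad H_i=t+\tfrac{z_i-tz_{i+1}}{z_i-z_{i+1}}(s_i-1),\quad T_i^{-1}=t^{-1}-1+t^{-1}T_i,$$ $$\Phi_q=z_nT_{n-1}^{-1}\cdots T_1^{-1},\qquad \Phi_q^*f=(z_n-t^{-n+1})\,f(z_n/q,z_1,\dots,z_{n-1}).$$ Let $l'_\eta(i)=\#\{j<i:\eta_j\ge\eta_i\}+\#\{j>i:\eta_j>\eta_i\}$, $\bar\eta_i=q^{\eta_i}t^{-l'_\eta(i)}$, $\delta=\delta_{i,\eta}=\bar\eta_i/\bar\eta_{i+1}$ and $a=a_{i,\eta}=\frac{t-1}{1-\delta^{-1}}$. There is exactly one family $(E_\eta)$ (the nonsymmetric Macdonald polynomials) such that $E_{(0,\dots,0)}=1$, $\Phi_qE_\eta=t^{-\#\{i>1:\eta_i\le\eta_1\}}E_{\Phi\eta}$,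 and $T_iE_\eta$ equals $aE_\eta+tE_{s_i\eta}$ if $\eta_i<\eta_{i+1}$, equals $tE_\eta$ if $\eta_i=\eta_{i+1}$, and equals $aE_\eta+\frac{(1-t\delta)(1-t^{-1}\delta)}{(1-\delta)^2}E_{s_i\eta}$ if $\eta_i>\eta_{i+1}$. There is exactly one family $(E^*_\eta)$ (the interpolation Macdonald polynomials) such that $E^*_{(0,\dots,0)}=1$, $\Phi^*_qE^*_\eta=q^{-\eta_1}E^*_{\Phi\eta}$, and $H_iE^*_\eta$ equals $aE^*_\eta+E^*_{s_i\eta}$ if $\eta_i<\eta_{i+1}$, equals $tE^*_\eta$ if $\eta_i=\eta_{i+1}$, and equals $aE^*_\eta+\frac{(1-t\delta)(t-\delta)}{(1-\delta)^2}E^*_{s_i\eta}$ if $\eta_i>\eta_{i+1}$. The recursion above, run with the explicit formulas obtained by solving these relations, namely $$E_{\Phi\eta}=t^{\#\{i>1:\eta_i\le\eta_1\}}\Phi_qE_\eta,\qquad E_{s_i\eta}=\begin{cases}t^{-1}T_iE_\eta-t^{-1}aE_\eta,&\eta_i<\eta_{i+1},\\ E_\eta,&\eta_i=\eta_{i+1},\\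 \frac{(1-\delta)^2}{(1-t\delta)(1-t^{-1}\delta)}\,(T_iE_\eta-aE_\eta),&\eta_i>\eta_{i+1},\end{cases}$$ respectively $$E^*_{\Phi\eta}=q^{\eta_1}\Phi_q^*E^*_\eta,\qquad E^*_{s_i\eta}=\begin{cases}H_iE^*_\eta-aE^*_\eta,&\eta_i<\eta_{i+1},\\ E^*_\eta,&\eta_i=\eta_{i+1},\\ \frac{(1-\delta)^2}{(1-t\delta)(t-\delta)}\,(H_iE^*_\eta-aE^*_\eta),&\eta_i>\eta_{i+1},\end{cases}$$ is at the pair $(E_{\eta(j)},\eta(j))$, respectively $(E^*_{\eta(j)},\eta(j))$, after each number $j\le|R(\eta)|$ of steps, and so ends after $|R(\eta)|$ steps with $(E_\eta,\eta)$, respectively $(E^*_\eta,\eta)$. -/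

import Mathlib

namespace RecGen

open MvPolynomial

/-- Compositions of length `n`: `n`-tuples of non-negative integers. -/
abbrev Comp (n : ℕ) : Type := Fin n → ℕ

section Compositions

variable {n : ℕ} [NeZero n]

/-- The position with the one-based number `i`, for `1 ≤ i ≤ n`. Thus `η (pos n i)` is the
component `η_i`, and `X (pos n i)` is the variable `z_i`. -/
def pos (n : ℕ) [NeZero n] (i : ℕ) : Fin n := Fin.ofNat n (i - 1)

/-- The switching operator `s_i`, for `1 ≤ i ≤ n - 1`, on compositions. -/
def switch (i : ℕ) (η : Comp n) : Comp n :=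
  fun j => η (Equiv.swap (pos n i) (pos n (i + 1)) j)

/-- The raising operator `Φ (η_1, …, η_n) = (η_2, …, η_n, η_1 + 1)`. -/
def raise (η : Comp n) : Comp n :=
  fun j => if h : (j : ℕ) + 1 < n then η ⟨j + 1, h⟩ else η (pos n 1) + 1

/-- The operator denoted by the letter `a`: the letter `0` stands for `Φ`, and a letter
`a = 1, …, n - 1` stands for `s_a`. -/
def act (a : ℕ) (η : Comp n) : Comp n := if a = 0 then raise η else switch a η

/-- Apply the operators of a word successively, the leftmost letter first. -/
def actWord (w : List ℕ) (η : Comp n) : Comp n := w.foldl (fun c a => act a c) η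

/-- `l_{η,i}`, the number of components smaller than `i`. -/
def lowCount (η : Comp n) (i : ℕ) : ℕ := (Finset.univ.filter fun j => η j < i).card

/-- `g_{η,i}`, the number of components greater than or equal to `i`. -/
def highCount (η : Comp n) (i : ℕ) : ℕ := (Finset.univ.filter fun j => i ≤ η j).card

/-- `σ(η,i) = (l,…,1, l+1,…,2, …, l+g-1,…,g)` with `l = l_{η,i-1}` and `g = g_{η,i}`,
the letters being listed in the order in which they are applied. -/
def sigma (η : Comp n) (i : ℕ) : List ℕ :=
  (List.range (highCount η i)).flatMap fun k =>
    (List.range (lowCount η (i - 1))).map fun a => lowCount η (i - 1) + k - a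

/-- The word of `r_{η,i}`: first the switches `σ(η,i)` (absent for `i = 1`), then `Φ` applied
`g_{η,i}` times. -/
def raisingWord (η : Comp n) (i : ℕ) : List ℕ :=
  (if i = 1 then [] else sigma η i) ++ List.replicate (highCount η i) 0

/-- The composition `(η⁺)ᴿ`: the components of `η` in weakly increasing order. -/
def increasing (η : Comp n) : Comp n := η ∘ Tuple.sort η

/-- `p_{η,i}`: the largest `j ≤ i` whose component in the present composition `c` is `η_i`. -/
def closest (η c : Comp n) (i : ℕ) : ℕ :=
  Nat.findGreatest (fun j => 1 ≤ j ∧ c (pos n j) = η (pos n i)) i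

/-- `σ'(η,i) = (p_{η,i}, …, i - 1)` in the order of application (empty if `p_{η,i} = i`). -/
def sigma' (η c : Comp n) (i : ℕ) : List ℕ :=
  List.range' (closest η c i) (i - closest η c i)

/-- The word `σ'(η,i), σ'(η,i-1), …, σ'(η,2)`, each computed from the composition reached
so far, starting at `c`. -/
def reorderWord (η : Comp n) : ℕ → Comp n → List ℕ
  | 0, _ => []
  | 1, _ => []
  | (i + 2), c =>
      sigma' η c (i + 2) ++ reorderWord η (i + 1) (actWord (sigma' η c (i + 2)) c)

/-- The operator word `R(η)`: the words of `r_{η,1}, …, r_{η,max η}` followed by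
`σ'(η,n), …, σ'(η,2)`, written in the order of application. -/
def word (η : Comp n) : List ℕ :=
  ((List.range (Finset.univ.sup η)).flatMap fun k => raisingWord η (k + 1)) ++
    reorderWord η n (increasing η)

/-- One step of the recursive generation. The state is the present polynomial together with
the composition labelling it; `sw i η` and `ra η` are the formulas that are applied to the
polynomial labelled by `η` to pass to the labels `s_i η` and `Φ η`. -/
def RGstep {P : Type*} (sw : ℕ → Comp n → P → P) (ra : Comp n → P → P)
    (x : P × Comp n) (a : ℕ) : P × Comp n :=
  if a = 0 then (ra x.2 x.1, raise x.2) else (sw a x.2 x.1, switch a x.2)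

/-- The state reached from `(1, (0,…,0))` after the first `j` letters of `R(η)`. -/
def RG {P : Type*} [One P] (sw : ℕ → Comp n → P → P) (ra : Comp n → P → P)
    (η : Comp n) (j : ℕ) : P × Comp n :=
  ((word η).take j).foldl (RGstep sw ra) (1, 0)

/-- The composition `η(j)` obtained from `(0,…,0)` by the first `j` letters of `R(η)`. -/
def stage (η : Comp n) (j : ℕ) : Comp n := actWord ((word η).take j) 0

end Compositions

noncomputable section Operators

variable {n : ℕ} [NeZero n] {K : Type*} [Field K]

/-- `s_i` on polynomials: exchange the variables `z_i` and `z_{i+1}`. -/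
def swapVars (i : ℕ) (f : MvPolynomial (Fin n) K) : MvPolynomial (Fin n) K :=
  rename (Equiv.swap (pos n i) (pos n (i + 1))) f

theorem dvd_swapVars_sub (i : ℕ) (f : MvPolynomial (Fin n) K) :
    (X (pos n i) - X (pos n (i + 1)) : MvPolynomial (Fin n) K) ∣ swapVars i f - f := by
  unfold swapVars
  induction f using MvPolynomial.induction_on with
  | C a => simp
  | add p r hp hr =>
    have := dvd_add hp hr
    rw [map_add]
    convert this using 1
    ring
  | mul_X p j hp =>
    have hX : (X (pos n i) - X (pos n (i + 1)) : MvPolynomial (Fin n) K) ∣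
        X (Equiv.swap (pos n i) (pos n (i + 1)) j) - X j := by
      by_cases h1 : j = pos n i
      · subst h1
        rw [Equiv.swap_apply_left]
        exact ⟨-1, by ring⟩
      · by_cases h2 : j = pos n (i + 1)
        · subst h2
          rw [Equiv.swap_apply_right]
        · rw [Equiv.swap_apply_of_ne_of_ne h1 h2, sub_self]
          exact dvd_zero _
    rw [map_mul, rename_X]
    have := dvd_add (Dvd.dvd.mul_right hp (X (Equiv.swap (pos n i) (pos n (i + 1)) j)))
      (Dvd.dvd.mul_left hX p)
    convert this using 1
    ring

/-- The polynomial `(s_i f - f) / (z_i - z_{i+1})`. -/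
def divDiff (i : ℕ) (f : MvPolynomial (Fin n) K) : MvPolynomial (Fin n) K :=
  (dvd_swapVars_sub i f).choose

theorem divDiff_spec (i : ℕ) (f : MvPolynomial (Fin n) K) :
    (X (pos n i) - X (pos n (i + 1))) * divDiff i f = swapVars i f - f :=
  (dvd_swapVars_sub i f).choose_spec.symm

/-- `T_i = t + (t z_i - z_{i+1}) / (z_i - z_{i+1}) (s_i - 1)`. -/
def T (t : K) (i : ℕ) (f : MvPolynomial (Fin n) K) : MvPolynomial (Fin n) K :=
  C t * f + (C t * X (pos n i) - X (pos n (i + 1))) * divDiff i f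

/-- `H_i = t + (z_i - t z_{i+1}) / (z_i - z_{i+1}) (s_i - 1)`. -/
def H (t : K) (i : ℕ) (f : MvPolynomial (Fin n) K) : MvPolynomial (Fin n) K :=
  C t * f + (X (pos n i) - C t * X (pos n (i + 1))) * divDiff i f

/-- `T_i⁻¹ = t⁻¹ - 1 + t⁻¹ T_i`. -/
def Tinv (t : K) (i : ℕ) (f : MvPolynomial (Fin n) K) : MvPolynomial (Fin n) K :=
  C (t⁻¹ - 1) * f + C t⁻¹ * T t i f

/-- `Φ_q = z_n T_{n-1}⁻¹ ⋯ T_1⁻¹` (the operator `T_1⁻¹` acts first). -/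
def raiseE (t : K) (f : MvPolynomial (Fin n) K) : MvPolynomial (Fin n) K :=
  X (pos n n) * (List.range' 1 (n - 1)).foldl (fun g i => Tinv t i g) f

/-- `Δ f (z_1, …, z_n) = f (z_n / q, z_1, …, z_{n-1})`. -/
def shift (q : K) (f : MvPolynomial (Fin n) K) : MvPolynomial (Fin n) K :=
  aeval (fun j : Fin n =>
    if (j : ℕ) = 0 then (C q⁻¹ * X (pos n n) : MvPolynomial (Fin n) K)
    else X (pos n (j : ℕ))) f

/-- `Φ_q^* = (z_n - t^{-n+1}) Δ`. -/
def raiseI (q t : K) (f : MvPolynomial (Fin n) K) : MvPolynomial (Fin n) K :=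
  (X (pos n n) - C (t ^ (n - 1))⁻¹) * shift q f

/-- `l'_η(i) = #{j < i; η_j ≥ η_i} + #{j > i; η_j > η_i}`. -/
def coleg (η : Comp n) (i : Fin n) : ℕ :=
  (Finset.univ.filter fun j => j < i ∧ η i ≤ η j).card +
    (Finset.univ.filter fun j => i < j ∧ η i < η j).card

/-- The spectral value `q^{η_i} t^{-l'_η(i)}`. -/
def bar (q t : K) (η : Comp n) (i : Fin n) : K := q ^ η i * (t ^ coleg η i)⁻¹

/-- `δ_{i,η}`, the quotient of the `i`-th and `(i+1)`-st spectral values. -/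
def delta (q t : K) (i : ℕ) (η : Comp n) : K :=
  bar q t η (pos n i) / bar q t η (pos n (i + 1))

/-- `#{i > 1; η_i ≤ η_1}`. -/
def firstCount (η : Comp n) : ℕ :=
  (Finset.univ.filter fun j => pos n 1 < j ∧ η j ≤ η (pos n 1)).card

/-- The coefficient `(t - 1) / (1 - δ_{i,η}⁻¹)`. -/
def diagCoeff (q t : K) (i : ℕ) (η : Comp n) : K := (t - 1) / (1 - (delta q t i η)⁻¹)

/-- `E` is the family of nonsymmetric Macdonald polynomials: `E_{(0,…,0)} = 1`, and the
Demazure-Lustig operators `T_i` and the raising operator `Φ_q` act on `E` by the standard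
formulas. -/
structure IsNonsymmetricMacdonald (q t : K) (E : Comp n → MvPolynomial (Fin n) K) : Prop where
  init : E 0 = 1
  switch_lt : ∀ (η : Comp n) (i : ℕ), 1 ≤ i → i < n → η (pos n i) < η (pos n (i + 1)) →
    T t i (E η) = C (diagCoeff q t i η) * E η + C t * E (switch i η)
  switch_eq : ∀ (η : Comp n) (i : ℕ), 1 ≤ i → i < n → η (pos n i) = η (pos n (i + 1)) →
    T t i (E η) = C t * E η
  switch_gt : ∀ (η : Comp n) (i : ℕ), 1 ≤ i → i < n → η (pos n (i + 1)) < η (pos n i) →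
    T t i (E η) = C (diagCoeff q t i η) * E η +
      C ((1 - t * delta q t i η) * (1 - t⁻¹ * delta q t i η) / (1 - delta q t i η) ^ 2) *
        E (switch i η)
  raise_eq : ∀ η : Comp n, raiseE t (E η) = C (t ^ firstCount η)⁻¹ * E (raise η)

/-- `E` is the family of interpolation Macdonald polynomials: `E_{(0,…,0)} = 1`, and the
Hecke operators `H_i` and the raising operator `Φ_q^*` act on `E` by the standard formulas. -/
structure IsInterpolationMacdonald (q t : K) (E : Comp n → MvPolynomial (Fin n) K) : Prop where
  init : E 0 = 1
  switch_lt : ∀ (η : Comp n) (i : ℕ), 1 ≤ i → i < n → η (pos n i) < η (pos n (i + 1)) →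
    H t i (E η) = C (diagCoeff q t i η) * E η + E (switch i η)
  switch_eq : ∀ (η : Comp n) (i : ℕ), 1 ≤ i → i < n → η (pos n i) = η (pos n (i + 1)) →
    H t i (E η) = C t * E η
  switch_gt : ∀ (η : Comp n) (i : ℕ), 1 ≤ i → i < n → η (pos n (i + 1)) < η (pos n i) →
    H t i (E η) = C (diagCoeff q t i η) * E η +
      C ((1 - t * delta q t i η) * (t - delta q t i η) / (1 - delta q t i η) ^ 2) *
        E (switch i η)
  raise_eq : ∀ η : Comp n, raiseI q t (E η) = C (q ^ η (pos n 1))⁻¹ * E (raise η)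

/-- The switching-type formula computing `E_{s_i η}` from `f = E_η`. -/
def switchFormulaE (q t : K) (i : ℕ) (η : Comp n) (f : MvPolynomial (Fin n) K) :
    MvPolynomial (Fin n) K :=
  if η (pos n i) < η (pos n (i + 1)) then
    C t⁻¹ * T t i f - C (t⁻¹ * diagCoeff q t i η) * f
  else if η (pos n i) = η (pos n (i + 1)) then f
  else C ((1 - delta q t i η) ^ 2 /
      ((1 - t * delta q t i η) * (1 - t⁻¹ * delta q t i η))) *
    (T t i f - C (diagCoeff q t i η) * f)

/-- The raising-type formula computing `E_{Φ η}` from `f = E_η`. -/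
def raiseFormulaE (t : K) (η : Comp n) (f : MvPolynomial (Fin n) K) :
    MvPolynomial (Fin n) K :=
  C (t ^ firstCount η) * raiseE t f

/-- The switching-type formula computing `E^*_{s_i η}` from `f = E^*_η`. -/
def switchFormulaI (q t : K) (i : ℕ) (η : Comp n) (f : MvPolynomial (Fin n) K) :
    MvPolynomial (Fin n) K :=
  if η (pos n i) < η (pos n (i + 1)) then
    H t i f - C (diagCoeff q t i η) * f
  else if η (pos n i) = η (pos n (i + 1)) then f
  else C ((1 - delta q t i η) ^ 2 /
      ((1 - t * delta q t i η) * (t - delta q t i η))) *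
    (H t i f - C (diagCoeff q t i η) * f)

/-- The raising-type formula computing `E^*_{Φ η}` from `f = E^*_η`. -/
def raiseFormulaI (q t : K) (η : Comp n) (f : MvPolynomial (Fin n) K) :
    MvPolynomial (Fin n) K :=
  C (q ^ η (pos n 1)) * raiseI q t f

end Operators

/-- Generic parameters: `q` and `t` are nonzero and satisfy no relation `q^a t^b = 1` with
`a ≥ 1`. Indeterminates `q`, `t` are generic in this sense. -/
def GenericParams {K : Type*} [Field K] (q t : K) : Prop :=
  q ≠ 0 ∧ t ≠ 0 ∧ ∀ (a : ℕ) (b : ℤ), 1 ≤ a → q ^ a * t ^ b ≠ 1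

end RecGen

namespace RecGen

open MvPolynomial

/-! ### The operator word R(η) and the generic recursion -/

section Words

variable {n : ℕ}

/-! The combinatorial half rests on truncations. With c the increasing rearrangement of η, the block
r_{η,k+1} turns min(c, k) into min(c, k+1): its switches bring the g entries still to be raised to
the front, and Φ^g raises them and returns them to the end (`actWord_raisingWord`). At k = max η
this is c, and the last block of the word fixes the positions of η from right to left
(`reorderWord_spec`). Correctness of the recursion is then an induction on the word
(`foldl_RGstep`), and it gives uniqueness of both Macdonald families: any family satisfying the
relations is what the recursion computes.

Existence is the substantial half. A polynomial of degree at most d is determined by arbitrary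
values at the spectral points of the compositions of size at most d (`exists_interpolation`,
`eq_zero_of_eval_bar`). So E*_η can be defined as the polynomial of degree at most |η| which
vanishes at all spectral points of size at most |η| except that of η, where it takes a prescribed
hook product. The operators H_i and Φ* relate values at the spectral points of ν, s_iν and Φν, so
each relation is checked point by point. The off-diagonal coefficients come from two recursions for
the hook product, `hookValue_raise` and `hookValue_swap`.

E_η is the top homogeneous part of E*_η for the parameters q⁻¹, t⁻¹. The operators T_i are affine in
H_i(t⁻¹), and H_i preserves degree, so the switching relations pass to top parts. The raising
relation does not pass directly, since Φ_q contains T_i⁻¹ where Φ* contains a shift. The bridge is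
the eigenvalue equation `add_descend_raiseI_interpolationPoly`, which says that E* + H_1⋯H_{n-1}Φ*E*
is z_1 times a scalar multiple of E*. Its top part, compared with H_1⋯H_{n-1} z_n H_{n-1}⋯H_1 =
t^{n-1} z_1, identifies Φ_q E with a multiple of the top part of Φ*E*. -/

theorem increasing_monotone (η : Comp n) : Monotone (increasing η) := Tuple.monotone_sort η

theorem card_filter_comp_perm (η : Comp n) (σ : Equiv.Perm (Fin n)) (P : ℕ → Prop)
    [DecidablePred P] :
    (Finset.univ.filter fun j => P ((η ∘ σ) j)).card = (Finset.univ.filter fun j => P (η j)).card :=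
  Finset.card_equiv σ (by simp)

theorem lowCount_increasing (η : Comp n) (k : ℕ) : lowCount (increasing η) k = lowCount η k :=
  card_filter_comp_perm η (Tuple.sort η) (· < k)

theorem lowCount_add_highCount (η : Comp n) (k : ℕ) : lowCount η k + highCount η k = n := by
  have := Finset.card_filter_add_card_filter_not (s := (Finset.univ : Finset (Fin n)))
    (fun j => η j < k)
  simpa [lowCount, highCount] using this

theorem lowCount_mono (η : Comp n) {k l : ℕ} (h : k ≤ l) : lowCount η k ≤ lowCount η l := by
  apply Finset.card_le_card
  intro j
  simp only [Finset.mem_filter, Finset.mem_univ, true_and]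
  omega

/-- The components of `η` in increasing order, cut off at `k`. -/
def truncated (η : Comp n) (k : ℕ) : Comp n := fun j => min (increasing η j) k

theorem truncated_zero (η : Comp n) : truncated η 0 = 0 := by
  funext j
  simp [truncated]

theorem truncated_sup (η : Comp n) : truncated η (Finset.univ.sup η) = increasing η := by
  funext j
  exact min_eq_left (Finset.le_sup (f := η) (Finset.mem_univ _))

variable [NeZero n]

theorem pos_val {i : ℕ} (hi : i ≤ n) : (pos n i : ℕ) = i - 1 := by
  have := NeZero.pos n
  simp only [pos, Fin.ofNat]
  exact Nat.mod_eq_of_lt (by omega)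

theorem pos_val_succ (j : Fin n) : pos n (j + 1) = j :=
  Fin.ext (by rw [pos_val (by omega)]; omega)

theorem pos_injOn {i j : ℕ} (hi : 1 ≤ i) (hin : i ≤ n) (hj : 1 ≤ j) (hjn : j ≤ n) :
    pos n i = pos n j ↔ i = j := by
  rw [Fin.ext_iff, pos_val hin, pos_val hjn]
  omega

theorem pos_ne_pos_succ {i : ℕ} (hi : 1 ≤ i) (hin : i < n) : pos n i ≠ pos n (i + 1) := by
  rw [Ne, pos_injOn hi hin.le (by omega) (by omega)]
  omega

/-- The component of `η` with the zero-based number `j`. -/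
def entry (η : Comp n) (j : ℕ) : ℕ := η (pos n (j + 1))

theorem entry_val (η : Comp n) (j : Fin n) : entry η j = η j := by
  rw [entry, pos_val_succ]

theorem ext_entry {η ν : Comp n} (h : ∀ j < n, entry η j = entry ν j) : η = ν := by
  funext j
  rw [← entry_val η, h j j.2, entry_val]

theorem entry_switch (η : Comp n) {i j : ℕ} (hi : 1 ≤ i) (hin : i < n) (hj : j < n) :
    entry (switch i η) j =
      if j + 1 = i then entry η i else if j = i then entry η (i - 1) else entry η j := by
  unfold entry switch
  split_ifs with h1 h2
  · subst h1
    rw [Equiv.swap_apply_left]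
  · subst h2
    rw [Equiv.swap_apply_right, Nat.sub_add_cancel hi]
  · rw [Equiv.swap_apply_of_ne_of_ne]
    · rw [Ne, pos_injOn] <;> omega
    · rw [Ne, pos_injOn] <;> omega

theorem entry_raise (η : Comp n) {j : ℕ} (hj : j < n) :
    entry (raise η) j = if j + 1 < n then entry η (j + 1) else entry η 0 + 1 := by
  have hv : (pos n (j + 1) : ℕ) = j := pos_val hj
  by_cases h : j + 1 < n
  · have h' : (pos n (j + 1) : ℕ) + 1 < n := by omega
    rw [if_pos h, entry, raise, dif_pos h', entry]
    congr 1
    apply Fin.ext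
    rw [pos_val (i := j + 1 + 1) (by omega)]
    exact congrArg (· + 1) hv
  · have h' : ¬ (pos n (j + 1) : ℕ) + 1 < n := by omega
    rw [if_neg h, entry, raise, dif_neg h', entry]

theorem actWord_append (u v : List ℕ) (η : Comp n) :
    actWord (u ++ v) η = actWord v (actWord u η) := by
  simp [actWord]

theorem actWord_cons (a : ℕ) (v : List ℕ) (η : Comp n) :
    actWord (a :: v) η = actWord v (act a η) := rfl

theorem actWord_nil (η : Comp n) : actWord [] η = η := rfl

theorem act_of_pos {a : ℕ} (ha : 1 ≤ a) (η : Comp n) : act a η = switch a η :=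
  if_neg (by omega)

theorem act_zero (η : Comp n) : act 0 η = raise η := if_pos rfl

/-- A descending run of adjacent switches is a cycle: it carries one entry to the left past l
others, each of which moves one place to the right. -/
theorem entry_actWord_descending (l k : ℕ) (c : Comp n) (h : l + k < n) {j : ℕ} (hj : j < n) :
    entry (actWord ((List.range l).map fun a => l + k - a) c) j =
      if j = k then entry c (l + k) else if k < j ∧ j ≤ l + k then entry c (j - 1)
      else entry c j := by
  induction l generalizing c with
  | zero =>
    simp only [List.range_zero, List.map_nil, actWord_nil, zero_add]
    split_ifs with h1 h2
    · rw [h1]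
    · omega
    · rfl
  | succ l ih =>
    have hw : (List.range (l + 1)).map (fun a => l + 1 + k - a) =
        (l + 1 + k) :: (List.range l).map fun a => l + k - a := by
      rw [List.range_succ_eq_map, List.map_cons, List.map_map]
      congr 1
      apply List.map_congr_left
      intro a _
      simp only [Function.comp_apply]
      omega
    have e : ∀ j < n, entry (switch (l + 1 + k) c) j = _ := fun j hj =>
      entry_switch c (by omega) h hj
    rw [hw, actWord_cons, act_of_pos (by omega), ih _ (by omega), e j hj, e (j - 1) (by omega),
      e (l + k) (by omega)]
    split_ifs <;> first | rfl | omega | (congr 1; omega)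

/-- Each run carries one more entry past the same l entries. Together the runs interchange two
adjacent segments, of lengths l and g, and keep the order inside each. -/
theorem entry_actWord_blocks (l g : ℕ) (c : Comp n) (h : l + g ≤ n) {j : ℕ} (hj : j < n) :
    entry (actWord ((List.range g).flatMap fun k => (List.range l).map fun a => l + k - a) c) j =
      if j < g then entry c (l + j) else if j < g + l then entry c (j - g) else entry c j := by
  induction g generalizing j with
  | zero =>
    simp only [List.range_zero, List.flatMap_nil, actWord_nil]
    split_ifs <;> first | rfl | omega
  | succ g ih =>
    rw [List.range_succ, List.flatMap_append, actWord_append]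
    simp only [List.flatMap_cons, List.flatMap_nil, List.append_nil]
    rw [entry_actWord_descending l g _ (by omega) hj, ih (by omega) (by omega),
      ih (by omega) (by omega), ih (by omega) hj]
    split_ifs <;> first | rfl | omega | (congr 1; omega)

theorem entry_actWord_replicate_zero (g : ℕ) (c : Comp n) (h : g ≤ n) {j : ℕ} (hj : j < n) :
    entry (actWord (List.replicate g 0) c) j =
      if j + g < n then entry c (j + g) else entry c (j + g - n) + 1 := by
  induction g generalizing j with
  | zero => simp [actWord_nil, hj]
  | succ g ih =>
    rw [List.replicate_succ', actWord_append, actWord_cons, actWord_nil, act_zero,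
      entry_raise _ hj]
    split_ifs with h1 h2 h2
    · rw [ih (by omega) h1, if_pos (by omega)]
      congr 1; omega
    · rw [ih (by omega) h1, if_neg (by omega)]
      congr 2; omega
    · omega
    · rw [ih (by omega) (by omega), if_pos (by omega)]
      congr 2; omega

theorem entry_increasing_lt (η : Comp n) {j : ℕ} (hj : j < n) (k : ℕ) :
    entry (increasing η) j < k ↔ j < lowCount η k := by
  have := Tuple.lt_card_lt_iff_apply_lt_of_monotone (j := ⟨j, hj⟩) (a := k)
    (increasing_monotone η)
  rw [← lowCount_increasing, lowCount, this, ← entry_val (increasing η)]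

theorem entry_truncated (η : Comp n) (k j : ℕ) :
    entry (truncated η k) j = min (entry (increasing η) j) k := rfl

/-- In the truncation at k, everything after the first l entries equals k. It is therefore harmless
that the switches pick the first g of these entries rather than the last g: raising any g of them
and placing them at the end gives the same composition. -/
theorem actWord_raisingWord (η : Comp n) (k : ℕ) :
    actWord (raisingWord η (k + 1)) (truncated η k) = truncated η (k + 1) := by
  -- No component is below 0, so for the letter block i = 1 the general formula already gives the
  -- empty word.
  have hs : (if k + 1 = 1 then [] else sigma η (k + 1)) = sigma η (k + 1) := by
    split_ifs with h
    · obtain rfl : k = 0 := by omega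
      simp [sigma, lowCount]
    · rfl
  rw [raisingWord, hs, actWord_append]
  apply ext_entry
  intro j hj
  have hl := lowCount_mono η (Nat.le_succ k)
  have hn := lowCount_add_highCount η (k + 1)
  have key : ∀ j < n, entry (actWord (sigma η (k + 1)) (truncated η k)) j = _ := fun j hj =>
    entry_actWord_blocks (lowCount η k) (highCount η (k + 1)) (truncated η k)
      (by simp only [Nat.succ_eq_add_one] at hl; omega) hj
  simp only [Nat.succ_eq_add_one] at hl
  rw [entry_actWord_replicate_zero _ _ (by omega) hj]
  simp only [entry_truncated] at key ⊢
  have e1 := entry_increasing_lt η hj k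
  have e2 := entry_increasing_lt η hj (k + 1)
  split_ifs with h1
  · rw [key _ h1, if_neg (by omega)]
    split_ifs with h2
    · rw [Nat.add_sub_cancel]
      omega
    · have e3 := entry_increasing_lt η h1 k
      have e4 := entry_increasing_lt η h1 (k + 1)
      omega
  · rw [key _ (by omega), if_pos (by omega)]
    have e3 := entry_increasing_lt η (j := lowCount η k + (j + highCount η (k + 1) - n))
      (by omega) k
    omega

theorem raisingWord_lt (η : Comp n) (k : ℕ) : ∀ a ∈ raisingWord η (k + 1), a < n := by
  intro a ha
  have hn := lowCount_add_highCount η (k + 1)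
  have hl := lowCount_mono η (Nat.le_succ k)
  simp only [Nat.succ_eq_add_one] at hl
  have := NeZero.pos n
  simp only [raisingWord, List.mem_append, List.mem_replicate] at ha
  rcases ha with ha | ha
  · split_ifs at ha with h
    · simp at ha
    · simp only [sigma, List.mem_flatMap, List.mem_map, List.mem_range, Nat.add_sub_cancel] at ha
      omega
  · omega

theorem actWord_raisingWords (η : Comp n) (m : ℕ) :
    actWord ((List.range m).flatMap fun k => raisingWord η (k + 1)) 0 = truncated η m := by
  induction m with
  | zero => rw [truncated_zero]; rfl
  | succ m ih =>
    rw [List.range_succ, List.flatMap_append, actWord_append, ih]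
    simp only [List.flatMap_cons, List.flatMap_nil, List.append_nil]
    exact actWord_raisingWord η m

theorem exists_perm_actWord {i : ℕ} (hi : i ≤ n) (w : List ℕ) (hw : ∀ a ∈ w, 1 ≤ a ∧ a < i)
    (c : Comp n) : ∃ σ : Equiv.Perm (Fin n),
      actWord w c = c ∘ σ ∧ ∀ j : Fin n, i ≤ j → actWord w c j = c j := by
  induction w generalizing c with
  | nil => exact ⟨1, rfl, fun j _ => rfl⟩
  | cons a w ih =>
    obtain ⟨h1, h2⟩ := hw a (by simp)
    obtain ⟨σ, hσ, hf⟩ := ih (fun b hb => hw b (by simp [hb])) (switch a c)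
    refine ⟨Equiv.swap (pos n a) (pos n (a + 1)) * σ, ?_, ?_⟩
    · rw [actWord_cons, act_of_pos h1, hσ]
      rfl
    · intro j hj
      rw [actWord_cons, act_of_pos h1, hf j hj, ← entry_val (switch a c),
        entry_switch c h1 (by omega) j.2, if_neg (by omega), if_neg (by omega), entry_val]

theorem entry_actWord_ascending (m p : ℕ) (hp : 1 ≤ p) (h : p + m ≤ n) (c : Comp n) :
    entry (actWord (List.range' p m) c) (p + m - 1) = entry c (p - 1) := by
  induction m generalizing p c with
  | zero => rfl
  | succ m ih =>
    rw [List.range'_succ, actWord_cons, act_of_pos hp]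
    have := ih (p + 1) (by omega) (by omega) (switch p c)
    rw [show p + (m + 1) - 1 = p + 1 + m - 1 by omega, this,
      entry_switch c hp (by omega) (by omega), if_neg (by omega), if_pos (by omega)]

/-- A count of multiplicities: if the value η_i did not occur up to position i, then c would have
strictly fewer entries of this value than η, since the two agree beyond i. -/
theorem exists_entry_eq (η c : Comp n) (hc : ∃ σ : Equiv.Perm (Fin n), c = η ∘ σ) {i : ℕ}
    (hin : i < n) (hfix : ∀ j : Fin n, i < j → c j = η j) :
    ∃ j ≤ i, entry c j = entry η i := by
  obtain ⟨σ, rfl⟩ := hc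
  by_contra! hne
  have hcard := card_filter_comp_perm η σ (· = entry η i)
  apply hcard.not_lt
  apply Finset.card_lt_card
  rw [Finset.ssubset_iff_of_subset]
  · refine ⟨⟨i, hin⟩, ?_, ?_⟩
    · simpa using (entry_val η ⟨i, hin⟩).symm
    · have := hne i le_rfl
      rw [show entry (η ∘ σ) i = (η ∘ σ) ⟨i, hin⟩ from entry_val (η ∘ σ) ⟨i, hin⟩] at this
      simpa using this
  · intro j hj
    simp only [Finset.mem_filter, Finset.mem_univ, true_and] at hj ⊢
    by_cases hji : i < j
    · rw [← hj, hfix j hji]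
    · exact absurd (by rw [entry_val]; exact hj) (hne j (by omega))

/-- The invariant is that c is a rearrangement of η which is already correct from zero-based
position i on. The ascending run carries a suitable entry into the last incorrect place and uses no
switch beyond it. -/
theorem reorderWord_spec (η : Comp n) (i : ℕ) (hi : i ≤ n) (c : Comp n)
    (hc : ∃ σ : Equiv.Perm (Fin n), c = η ∘ σ) (hfix : ∀ j : Fin n, i ≤ j → c j = η j) :
    actWord (reorderWord η i c) c = η ∧ ∀ a ∈ reorderWord η i c, a < n := by
  induction i generalizing c with
  | zero => exact ⟨funext fun j => hfix j (Nat.zero_le _), by simp [reorderWord]⟩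
  | succ i ih =>
    obtain ⟨j, hj, hje⟩ := exists_entry_eq η c hc (i := i) (by omega) fun j h => hfix j h
    cases i with
    | zero =>
      obtain rfl : j = 0 := by omega
      refine ⟨funext fun j => ?_, by simp [reorderWord]⟩
      by_cases h0 : (j : ℕ) = 0
      · rw [← h0, entry_val, entry_val] at hje
        exact hje
      · exact hfix j (by omega)
    | succ i =>
      -- The zero-based position j supplies the one-based witness j + 1, which excludes the default
      -- value 0 of `Nat.findGreatest`.
      have hspec := Nat.findGreatest_spec
        (P := fun j => 1 ≤ j ∧ c (pos n j) = η (pos n (i + 2))) (m := j + 1) (n := i + 2)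
        (by omega) ⟨by omega, hje⟩
      have hle : closest η c (i + 2) ≤ i + 2 := Nat.findGreatest_le _
      change 1 ≤ closest η c (i + 2) ∧ c (pos n (closest η c (i + 2))) = _ at hspec
      obtain ⟨hp, hpe⟩ := hspec
      have hletters : ∀ a ∈ sigma' η c (i + 2), 1 ≤ a ∧ a < i + 2 := by
        intro a ha
        simp only [sigma', List.mem_range'_1] at ha
        omega
      obtain ⟨σ, hσ, hf⟩ := exists_perm_actWord hi _ hletters c
      have hend : entry (actWord (sigma' η c (i + 2)) c) (i + 1) = entry η (i + 1) := by
        have := entry_actWord_ascending (i + 2 - closest η c (i + 2)) (closest η c (i + 2)) hp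
          (by omega) c
        rw [show closest η c (i + 2) + (i + 2 - closest η c (i + 2)) - 1 = i + 1 by omega] at this
        rw [sigma', this, entry, Nat.sub_add_cancel hp, hpe]
        rfl
      obtain ⟨τ, hτ⟩ := hc
      obtain ⟨h1, h2⟩ := ih (by omega) (actWord (sigma' η c (i + 2)) c)
        ⟨τ * σ, by rw [hσ, hτ]; rfl⟩ fun j hj => by
          by_cases hji : (j : ℕ) = i + 1
          · rw [← entry_val (actWord _ _), hji, hend, ← hji, entry_val]
          · rw [hf j (by omega), hfix j (by omega)]
      refine ⟨?_, ?_⟩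
      · rw [reorderWord, actWord_append, h1]
      · intro a ha
        rw [reorderWord, List.mem_append] at ha
        rcases ha with ha | ha
        · have := hletters a ha
          omega
        · exact h2 a ha

theorem word_lt (η : Comp n) : ∀ a ∈ word η, a < n := by
  intro a ha
  rw [word, List.mem_append, List.mem_flatMap] at ha
  rcases ha with ⟨k, _, ha⟩ | ha
  · exact raisingWord_lt η k a ha
  · exact (reorderWord_spec η n le_rfl _ ⟨_, rfl⟩ fun j hj => by omega).2 a ha

theorem actWord_word (η : Comp n) : actWord (word η) 0 = η := by
  rw [word, actWord_append, actWord_raisingWords, truncated_sup]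
  exact (reorderWord_spec η n le_rfl _ ⟨_, rfl⟩ fun j hj => by omega).1

theorem stage_length (η : Comp n) : stage η (word η).length = η := by
  rw [stage, List.take_length, actWord_word]

theorem foldl_RGstep {P : Type*} (F : Comp n → P) (sw : ℕ → Comp n → P → P) (ra : Comp n → P → P)
    (hsw : ∀ (ν : Comp n) (i : ℕ), 1 ≤ i → i < n → sw i ν (F ν) = F (switch i ν))
    (hra : ∀ ν : Comp n, ra ν (F ν) = F (raise ν)) (w : List ℕ) (hw : ∀ a ∈ w, a < n)
    (ν : Comp n) : w.foldl (RGstep sw ra) (F ν, ν) = (F (actWord w ν), actWord w ν) := by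
  induction w generalizing ν with
  | nil => rfl
  | cons a w ih =>
    have hstep : RGstep sw ra (F ν, ν) a = (F (act a ν), act a ν) := by
      by_cases ha : a = 0
      · simp [RGstep, act, ha, hra]
      · simp [RGstep, act, ha, hsw ν a (by omega) (hw a (by simp))]
    rw [List.foldl_cons, hstep, ih (fun b hb => hw b (by simp [hb])), actWord_cons]

theorem RG_eq {P : Type*} [One P] (F : Comp n → P) (sw : ℕ → Comp n → P → P)
    (ra : Comp n → P → P) (h0 : F 0 = 1)
    (hsw : ∀ (ν : Comp n) (i : ℕ), 1 ≤ i → i < n → sw i ν (F ν) = F (switch i ν))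
    (hra : ∀ ν : Comp n, ra ν (F ν) = F (raise ν)) (η : Comp n) :
    (∀ j ≤ (word η).length, RG sw ra η j = (F (stage η j), stage η j)) ∧
      RG sw ra η (word η).length = (F η, η) := by
  have key : ∀ j, RG sw ra η j = (F (stage η j), stage η j) := by
    intro j
    rw [RG, ← h0, foldl_RGstep F sw ra hsw hra _ fun a ha => word_lt η a (List.mem_of_mem_take ha)]
    rfl
  exact ⟨fun j _ => key j, by rw [key, stage_length]⟩

end Words

/-! ### Leg statistics under adjacent switches -/

section Spectrum

variable {n : ℕ}

/-- The statistic is a rank: it counts the positions before i when positions are sorted by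
decreasing component, ties being broken from left to right. -/
theorem coleg_eq_sum (η : Comp n) (i : Fin n) :
    coleg η i = ∑ j, if η i < η j ∨ η i = η j ∧ j < i then 1 else 0 := by
  rw [coleg, ← Finset.card_filter, ← Finset.card_union_of_disjoint]
  · congr 1
    ext j
    simp only [Finset.mem_union, Finset.mem_filter, Finset.mem_univ, true_and, Fin.lt_def]
    rcases eq_or_ne j i with rfl | h
    · simp
    · have : (j : ℕ) ≠ i := fun e => h (Fin.ext e)
      omega
  · rw [Finset.disjoint_filter]
    intro j _ h1 h2
    exact lt_asymm h1.1 h2.1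

theorem swap_lt_swap {a b : Fin n} (hab : (b : ℕ) = a + 1) {k r : Fin n}
    (h1 : ¬(r = a ∧ k = b)) (h2 : ¬(r = b ∧ k = a)) :
    Equiv.swap a b k < Equiv.swap a b r ↔ k < r := by
  rw [Equiv.swap_apply_def, Equiv.swap_apply_def]
  simp only [Fin.ext_iff, Fin.lt_def] at *
  split_ifs <;> omega

theorem coleg_swap {a b : Fin n} (hab : (b : ℕ) = a + 1) (η : Comp n) (hne : η a ≠ η b)
    (r : Fin n) : coleg (η ∘ Equiv.swap a b) (Equiv.swap a b r) = coleg η r := by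
  rw [coleg_eq_sum, coleg_eq_sum, ← Equiv.sum_comp (Equiv.swap a b)]
  apply Finset.sum_congr rfl
  intro k _
  simp only [Function.comp_apply, Equiv.swap_apply_self]
  by_cases h : η r = η k
  · have := swap_lt_swap hab (k := k) (r := r) (by rintro ⟨rfl, rfl⟩; exact hne h)
      (by rintro ⟨rfl, rfl⟩; exact hne h.symm)
    simp only [this]
  · simp [h]

theorem coleg_of_eq {a b : Fin n} (hab : (b : ℕ) = a + 1) (η : Comp n) (h : η a = η b) :
    coleg η b = coleg η a + 1 := by
  have h1 : (∑ k : Fin n, if k = a then 1 else 0) = 1 := by simp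
  rw [coleg_eq_sum, coleg_eq_sum, ← h1, ← Finset.sum_add_distrib]
  apply Finset.sum_congr rfl
  intro k _
  by_cases hk : k = a
  · subst hk
    have : k < b := by rw [Fin.lt_def]; omega
    simp [h, this]
  · have : k < b ↔ k < a := by
      simp only [Fin.lt_def, Fin.ext_iff] at *
      omega
    simp only [this, h, hk, if_false, add_zero]

/-- The leg length of the box in row `r` and (zero-based) column `j` of the diagram of `η`. -/
def leg (η : Comp n) (r : Fin n) (j : ℕ) : ℕ :=
  ∑ k, if k < r ∧ j ≤ η k ∧ η k < η r ∨ r < k ∧ j < η k ∧ η k ≤ η r then 1 else 0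

theorem leg_swap {a b : Fin n} (hab : (b : ℕ) = a + 1) (η : Comp n) (h : η a < η b)
    (r : Fin n) (j : ℕ) :
    leg η r j = leg (η ∘ Equiv.swap a b) (Equiv.swap a b r) j +
      if r = b ∧ j = η a then 1 else 0 := by
  -- The exceptional 1 is written as a sum concentrated at k = a, so that both sides can be compared
  -- term by term after reindexing by the switch.
  have h1 : (∑ k : Fin n, if k = a then (if r = b ∧ j = η a then 1 else 0) else 0) =
      if r = b ∧ j = η a then 1 else 0 := by simp
  unfold leg
  conv_rhs => rw [← h1, ← Equiv.sum_comp (Equiv.swap a b), ← Finset.sum_add_distrib]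
  apply Finset.sum_congr rfl
  intro k _
  simp only [Function.comp_apply, Equiv.swap_apply_self]
  have hab' : a < b := by rw [Fin.lt_def]; omega
  by_cases c1 : r = a ∧ k = b
  · obtain ⟨rfl, rfl⟩ := c1
    simp only [Equiv.swap_apply_left, Equiv.swap_apply_right, hab', hab'.not_gt, hab'.ne',
      if_false, add_zero, true_and, false_and, false_or, or_false]
    split_ifs <;> omega
  · by_cases c2 : r = b ∧ k = a
    · obtain ⟨rfl, rfl⟩ := c2
      simp only [Equiv.swap_apply_left, Equiv.swap_apply_right, hab', hab'.not_gt,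
        if_true, true_and, false_and, false_or, or_false]
      split_ifs <;> omega
    · have c3 : (if k = a then (if r = b ∧ j = η a then 1 else 0) else 0) = 0 := by
        by_cases hk : k = a
        · have : r ≠ b := fun hr => c2 ⟨hr, hk⟩
          simp [this]
        · simp [hk]
      simp only [c3, swap_lt_swap hab c1 c2, swap_lt_swap hab (fun h => c2 ⟨h.2, h.1⟩)
        (fun h => c1 ⟨h.2, h.1⟩), add_zero]

/-- The positions ranked from b up to just before a are those counted by the leg in row b and column
η a, with b itself matched to a by the switch. This ties the one box whose leg changes to the ratio
of two spectral values. -/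
theorem coleg_eq_add_leg {a b : Fin n} (hab : (b : ℕ) = a + 1) (η : Comp n) (h : η a < η b) :
    coleg η a = coleg η b + leg η b (η a) := by
  rw [coleg_eq_sum, coleg_eq_sum, leg, ← Equiv.sum_comp (Equiv.swap a b),
    ← Finset.sum_add_distrib]
  apply Finset.sum_congr rfl
  intro k _
  have hab' : a < b := by rw [Fin.lt_def]; omega
  by_cases c1 : k = a
  · subst c1
    simp only [Equiv.swap_apply_left]
    simp [h, hab', h.not_gt, h.ne']
  · by_cases c2 : k = b
    · subst c2
      simp
    · rw [Equiv.swap_apply_of_ne_of_ne c1 c2]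
      simp only [Fin.lt_def, Fin.ext_iff] at *
      split_ifs <;> omega

/-- The sum of `min (η r) (η k)` over all ordered pairs of distinct positions. -/
def pairSum (η : Comp n) : ℕ := ∑ r, ∑ k, if r = k then 0 else min (η r) (η k)

theorem pairSum_comp_perm (η : Comp n) (σ : Equiv.Perm (Fin n)) :
    pairSum (η ∘ σ) = pairSum η := by
  unfold pairSum
  rw [← Equiv.sum_comp σ fun r => ∑ k, if r = k then 0 else min (η r) (η k)]
  apply Finset.sum_congr rfl
  intro r _
  rw [← Equiv.sum_comp σ fun k => if σ r = k then 0 else min (η (σ r)) (η k)]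
  simp

end Spectrum

/-! ### Leg statistics under raising -/

section Raise

variable {m : ℕ}

theorem pos_one (m : ℕ) : pos (m + 1) 1 = 0 := rfl

theorem pos_last (m : ℕ) : pos (m + 1) (m + 1) = Fin.last m := Fin.ext (by simp [pos_val])

theorem raise_castSucc (η : Comp (m + 1)) (j : Fin m) : raise η j.castSucc = η j.succ := by
  rw [raise, dif_pos (by simp)]
  rfl

theorem raise_last (η : Comp (m + 1)) : raise η (Fin.last m) = η 0 + 1 := by
  rw [raise, dif_neg (by simp), pos_one]

theorem coleg_raise_castSucc (η : Comp (m + 1)) (i : Fin m) :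
    coleg (raise η) i.castSucc = coleg η i.succ := by
  rw [coleg_eq_sum, coleg_eq_sum, Fin.sum_univ_castSucc, Fin.sum_univ_succ, add_comm]
  simp only [raise_castSucc, raise_last, Fin.castSucc_lt_castSucc_iff, Fin.succ_lt_succ_iff]
  congr 1
  have h1 : ¬ Fin.last m < i.castSucc := by simp [Fin.le_last]
  simp only [h1, Fin.succ_pos, and_true, and_false, or_false]
  split_ifs <;> omega

theorem coleg_raise_last (η : Comp (m + 1)) :
    coleg (raise η) (Fin.last m) = coleg η 0 := by
  rw [coleg_eq_sum, coleg_eq_sum, Fin.sum_univ_castSucc, Fin.sum_univ_succ, add_comm]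
  simp only [raise_castSucc, raise_last, Fin.castSucc_lt_last]
  congr 1
  · simp
  · apply Finset.sum_congr rfl
    intro k _
    simp only [and_true, Fin.not_lt_zero, and_false, or_false]
    split_ifs <;> omega

theorem coleg_last_of_eq_zero (ν : Comp (m + 1)) (h : ν (Fin.last m) = 0) :
    coleg ν (Fin.last m) = m := by
  rw [coleg_eq_sum, Fin.sum_univ_castSucc]
  simp only [h, Fin.castSucc_lt_last]
  have : ∀ k : Fin m, (0 < ν k.castSucc ∨ 0 = ν k.castSucc ∧ True) := fun k =>
    (Nat.eq_zero_or_pos _).elim (fun e => .inr ⟨e.symm, trivial⟩) .inl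
  simp only [this]
  simp

theorem coleg_castSucc_of_eq_zero (ν : Comp (m + 1)) (h : ν (Fin.last m) = 0) (i : Fin m) :
    coleg ν i.castSucc = coleg (fun j => ν j.castSucc) i := by
  rw [coleg_eq_sum, coleg_eq_sum, Fin.sum_univ_castSucc]
  simp [h, Fin.le_last]

theorem firstCount_add_coleg (η : Comp (m + 1)) : firstCount η + coleg η 0 = m := by
  rw [firstCount, coleg_eq_sum, Finset.card_filter, pos_one, Fin.sum_univ_succ, Fin.sum_univ_succ]
  simp only [lt_self_iff_false, false_and, if_false, and_false, or_false, zero_add, Fin.succ_pos,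
    true_and, Fin.not_lt_zero]
  rw [← Finset.sum_add_distrib, Finset.sum_congr rfl (g := fun _ => 1)]
  · simp
  · intro k _
    split_ifs <;> omega

theorem leg_raise_castSucc (η : Comp (m + 1)) (r : Fin m) (j : ℕ) :
    leg (raise η) r.castSucc j = leg η r.succ j := by
  rw [leg, leg, Fin.sum_univ_castSucc, Fin.sum_univ_succ, add_comm]
  simp only [raise_castSucc, raise_last, Fin.castSucc_lt_castSucc_iff, Fin.succ_lt_succ_iff]
  congr 1
  have h1 : ¬ Fin.last m < r.castSucc := by simp [Fin.le_last]
  simp only [h1, Fin.succ_pos, Fin.castSucc_lt_last, Fin.not_lt_zero, false_and, false_or,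
    true_and, or_false]
  split_ifs <;> omega

/-- The boxes of the raised row move one column to the right with unchanged legs, so the new box is
the one in column 0. -/
theorem leg_raise_last_succ (η : Comp (m + 1)) (j : ℕ) :
    leg (raise η) (Fin.last m) (j + 1) = leg η 0 j := by
  rw [leg, leg, Fin.sum_univ_castSucc, Fin.sum_univ_succ, add_comm]
  simp only [raise_castSucc, raise_last, Fin.castSucc_lt_last]
  congr 1
  · simp
  · apply Finset.sum_congr rfl
    intro k _
    have h1 : ¬ Fin.last m < k.castSucc := by simp [Fin.le_last]
    simp only [h1, Fin.succ_pos, Fin.not_lt_zero, false_and, false_or, true_and, or_false]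
    split_ifs <;> omega

theorem leg_raise_last_zero (η : Comp (m + 1)) :
    leg (raise η) (Fin.last m) 0 = firstCount η := by
  rw [leg, firstCount, Finset.card_filter, pos_one, Fin.sum_univ_castSucc, Fin.sum_univ_succ,
    add_comm]
  simp only [raise_castSucc, raise_last, Fin.castSucc_lt_last]
  congr 1
  · simp
  · apply Finset.sum_congr rfl
    intro k _
    have h1 : ¬ Fin.last m < k.castSucc := by simp [Fin.le_last]
    simp only [h1, Fin.succ_pos, false_and, true_and, or_false]
    split_ifs <;> omega

/-- Raising η_1 increases min(η_1, η_k) exactly when η_k > η_1. Each such pair is counted in both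
orders. -/
theorem pairSum_raise (η : Comp (m + 1)) :
    pairSum (raise η) = pairSum η + 2 * coleg η 0 := by
  have hc : coleg η 0 = ∑ k : Fin m, if η 0 < η k.succ then 1 else 0 := by
    rw [coleg_eq_sum, Fin.sum_univ_succ]
    simp
  have hm : ∑ k : Fin m, min (η 0 + 1) (η k.succ) =
      ∑ k : Fin m, min (η 0) (η k.succ) + coleg η 0 := by
    rw [hc, ← Finset.sum_add_distrib]
    apply Finset.sum_congr rfl
    intro k _
    split_ifs <;> omega
  have hm' : ∑ k : Fin m, min (η k.succ) (η 0 + 1) =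
      ∑ k : Fin m, min (η k.succ) (η 0) + coleg η 0 := by
    simpa only [min_comm] using hm
  have h1 : pairSum (raise η) =
      (∑ r : Fin m, ∑ k : Fin m, if r = k then 0 else min (η r.succ) (η k.succ)) +
        ∑ r : Fin m, min (η r.succ) (η 0 + 1) + ∑ k : Fin m, min (η 0 + 1) (η k.succ) := by
    simp [pairSum, Fin.sum_univ_castSucc, raise_castSucc, raise_last, Finset.sum_add_distrib,
      (Fin.castSucc_lt_last _).ne, (Fin.castSucc_lt_last _).ne']
    ring
  have h2 : pairSum η = ∑ k : Fin m, min (η 0) (η k.succ) + (∑ r : Fin m, min (η r.succ) (η 0) +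
      ∑ r : Fin m, ∑ k : Fin m, if r = k then 0 else min (η r.succ) (η k.succ)) := by
    simp [pairSum, Fin.sum_univ_succ, Finset.sum_add_distrib, (Fin.succ_ne_zero _).symm]
    ring
  rw [h1, h2, hm, hm']
  ring

end Raise

/-! ### Recursions for the hook product -/

section Weights

variable {K : Type*} [Field K] {n : ℕ} {q t : K}

/-- The value at the spectral point of `η` of the interpolation polynomial labelled by `η`. -/
noncomputable def hookValue (q t : K) (η : Comp n) : K :=
  (∏ r, q ^ (η r).choose 2) * (t ^ (pairSum η / 2))⁻¹ *
    ∏ r, ∏ j ∈ Finset.range (η r), (q ^ (η r - j) - (t ^ leg η r j)⁻¹)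

theorem hookValue_zero (q t : K) : hookValue q t (0 : Comp n) = 1 := by
  simp [hookValue, pairSum]

theorem hookValue_raise {m : ℕ} (q t : K) (η : Comp (m + 1)) :
    hookValue q t (raise η) =
      q ^ η 0 * (q * bar q t η 0 - (t ^ m)⁻¹) * hookValue q t η := by
  have h1 : ∏ r, q ^ (raise η r).choose 2 = q ^ η 0 * ∏ r, q ^ (η r).choose 2 := by
    rw [Fin.prod_univ_castSucc, Fin.prod_univ_succ (n := m)]
    simp only [raise_castSucc, raise_last, Nat.choose_succ_succ' (η 0) 1, Nat.choose_one_right,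
      pow_add]
    ring
  -- The increment is even, so it can be halved without knowing the parity of the pair sum.
  have h2 : (t ^ (pairSum (raise η) / 2))⁻¹ = (t ^ (pairSum η / 2))⁻¹ * (t ^ coleg η 0)⁻¹ := by
    rw [pairSum_raise, Nat.add_mul_div_left _ _ two_pos, pow_add, mul_inv]
  have h3 : ∏ r, ∏ j ∈ Finset.range (raise η r),
        (q ^ (raise η r - j) - (t ^ leg (raise η) r j)⁻¹) =
      (∏ r, ∏ j ∈ Finset.range (η r), (q ^ (η r - j) - (t ^ leg η r j)⁻¹)) *
        (q ^ (η 0 + 1) - (t ^ firstCount η)⁻¹) := by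
    rw [Fin.prod_univ_castSucc, Fin.prod_univ_succ (n := m)]
    simp only [raise_castSucc, raise_last, leg_raise_castSucc, Finset.prod_range_succ',
      Nat.add_sub_add_right, leg_raise_last_succ, leg_raise_last_zero, Nat.sub_zero]
    ring
  have h4 : q * bar q t η 0 - (t ^ m)⁻¹ =
      (t ^ coleg η 0)⁻¹ * (q ^ (η 0 + 1) - (t ^ firstCount η)⁻¹) := by
    have hm : t ^ m = t ^ firstCount η * t ^ coleg η 0 := by
      rw [← pow_add, firstCount_add_coleg η]
    rw [hm, bar, mul_inv]
    ring
  rw [hookValue, h1, h2, h3, h4, hookValue]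
  ring

/-- Only the factor of the box in row b, column η a changes. By `coleg_eq_add_leg` it is
proportional to bar b − bar a. Its leg drops by one under the switch, and the factor becomes
proportional to bar b − t · bar a on the same scale. -/
theorem hookValue_swap (ht : t ≠ 0) {a b : Fin n} (hab : (b : ℕ) = a + 1)
    (η : Comp n) (h : η a < η b) :
    hookValue q t (η ∘ Equiv.swap a b) * (bar q t η b - bar q t η a) =
      (bar q t η b - t * bar q t η a) * hookValue q t η := by
  have h1 : ∏ r, q ^ ((η ∘ Equiv.swap a b) r).choose 2 = ∏ r, q ^ (η r).choose 2 :=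
    Equiv.prod_comp (Equiv.swap a b) fun r => q ^ (η r).choose 2
  have h2 : leg η b (η a) = leg (η ∘ Equiv.swap a b) a (η a) + 1 := by
    simpa using leg_swap hab η h b (η a)
  have h3 : ∏ r, ∏ j ∈ Finset.range ((η ∘ Equiv.swap a b) r),
      (q ^ ((η ∘ Equiv.swap a b) r - j) - (t ^ leg (η ∘ Equiv.swap a b) r j)⁻¹) =
      ∏ r, ∏ j ∈ Finset.range (η r),
        (q ^ (η r - j) - (t ^ leg (η ∘ Equiv.swap a b) (Equiv.swap a b r) j)⁻¹) := by
    rw [← Equiv.prod_comp (Equiv.swap a b)]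
    simp
  have hmem : η a ∈ Finset.range (η b) := Finset.mem_range.2 h
  have h4 : ∀ s : Fin n → ℕ → ℕ, ∏ r, ∏ j ∈ Finset.range (η r), (q ^ (η r - j) - (t ^ s r j)⁻¹) =
      (q ^ (η b - η a) - (t ^ s b (η a))⁻¹) *
        ((∏ j ∈ (Finset.range (η b)).erase (η a), (q ^ (η b - j) - (t ^ s b j)⁻¹)) *
          ∏ r ∈ Finset.univ.erase b, ∏ j ∈ Finset.range (η r),
            (q ^ (η r - j) - (t ^ s r j)⁻¹)) := by
    intro s
    rw [← Finset.mul_prod_erase _ _ (Finset.mem_univ b), ← Finset.mul_prod_erase _ _ hmem]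
    ring
  have h5 : ∏ j ∈ (Finset.range (η b)).erase (η a),
        (q ^ (η b - j) - (t ^ leg (η ∘ Equiv.swap a b) (Equiv.swap a b b) j)⁻¹) =
      ∏ j ∈ (Finset.range (η b)).erase (η a), (q ^ (η b - j) - (t ^ leg η b j)⁻¹) := by
    apply Finset.prod_congr rfl
    intro j hj
    rw [leg_swap hab η h b j, if_neg (fun e => Finset.ne_of_mem_erase hj e.2), add_zero]
  have h6 : ∏ r ∈ Finset.univ.erase b, ∏ j ∈ Finset.range (η r),
        (q ^ (η r - j) - (t ^ leg (η ∘ Equiv.swap a b) (Equiv.swap a b r) j)⁻¹) =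
      ∏ r ∈ Finset.univ.erase b, ∏ j ∈ Finset.range (η r),
        (q ^ (η r - j) - (t ^ leg η r j)⁻¹) := by
    apply Finset.prod_congr rfl
    intro r hr
    apply Finset.prod_congr rfl
    intro j _
    rw [leg_swap hab η h r j, if_neg (fun e => Finset.ne_of_mem_erase hr e.1), add_zero]
  have h7 : bar q t η a = q ^ η a * (t ^ coleg η b)⁻¹ * (t ^ leg η b (η a))⁻¹ := by
    rw [bar, coleg_eq_add_leg hab η h, pow_add, mul_inv, mul_assoc]
  have h8 : bar q t η b = q ^ η a * (t ^ coleg η b)⁻¹ * q ^ (η b - η a) := by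
    rw [bar]
    nth_rewrite 1 [← Nat.add_sub_cancel' h.le]
    rw [pow_add]
    ring
  have h9 : (t ^ leg (η ∘ Equiv.swap a b) a (η a))⁻¹ = t * (t ^ leg η b (η a))⁻¹ := by
    rw [h2, pow_succ]
    field_simp
  rw [hookValue, h1, pairSum_comp_perm, h3, h4, h5, h6, Equiv.swap_apply_right, h9, h7, h8,
    hookValue, h4 (leg η)]
  ring

end Weights

/-! ### Spectral values and genericity -/

section Bar

variable {K : Type*} [Field K] {n : ℕ} {q t : K}

/-- Equality would give a relation q^e t^f = 1 with e = |a − b| ≥ 1. All separation of spectral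
values used below reduces to this. -/
theorem GenericParams.pow_mul_ne (h : GenericParams q t) {a b c d : ℕ} (hab : a ≠ b) :
    q ^ a * (t ^ c)⁻¹ ≠ q ^ b * (t ^ d)⁻¹ := by
  obtain ⟨hq, ht, h⟩ := h
  have key : ∀ a b c d : ℕ, a < b → q ^ a * (t ^ c)⁻¹ ≠ q ^ b * (t ^ d)⁻¹ := by
    intro a b c d hab e
    apply h (b - a) ((c : ℤ) - d) (by omega)
    rw [zpow_sub₀ ht, zpow_natCast, zpow_natCast]
    have hb : q ^ b = q ^ a * q ^ (b - a) := by rw [← pow_add, Nat.add_sub_cancel' hab.le]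
    rw [hb] at e
    field_simp at e ⊢
    exact e.symm
  rcases lt_or_gt_of_ne hab with hlt | hlt
  · exact key _ _ _ _ hlt
  · exact (key _ _ _ _ hlt).symm

theorem GenericParams.inv (h : GenericParams q t) : GenericParams q⁻¹ t⁻¹ := by
  refine ⟨inv_ne_zero h.1, inv_ne_zero h.2.1, fun a b ha e => h.2.2 a b ha ?_⟩
  rwa [inv_pow, inv_zpow, ← mul_inv, inv_eq_one] at e

theorem GenericParams.bar_ne_zero (h : GenericParams q t) (η : Comp n) (i : Fin n) :
    bar q t η i ≠ 0 :=
  mul_ne_zero (pow_ne_zero _ h.1) (inv_ne_zero (pow_ne_zero _ h.2.1))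

theorem GenericParams.bar_ne_bar (h : GenericParams q t) {η : Comp n} {i j : Fin n}
    (hij : η i ≠ η j) : bar q t η i ≠ bar q t η j := h.pow_mul_ne hij

theorem GenericParams.mul_bar_ne_bar (h : GenericParams q t) {η : Comp n} {i j : Fin n}
    (hij : η i ≠ η j) : t * bar q t η i ≠ bar q t η j := by
  intro e
  have ht := h.2.1
  apply h.pow_mul_ne (c := coleg η i) (d := coleg η j + 1) hij
  unfold bar at e
  rw [pow_succ, mul_inv, ← mul_assoc, ← e]
  field_simp

theorem bar_swap {a b : Fin n} (hab : (b : ℕ) = a + 1) (η : Comp n) (hne : η a ≠ η b) :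
    bar q t (η ∘ Equiv.swap a b) = bar q t η ∘ Equiv.swap a b := by
  funext r
  have := coleg_swap hab η hne (Equiv.swap a b r)
  rw [Equiv.swap_apply_self] at this
  simp only [bar, this, Function.comp_apply]

theorem bar_of_eq (ht : t ≠ 0) {a b : Fin n} (hab : (b : ℕ) = a + 1) (η : Comp n)
    (h : η a = η b) : bar q t η a = t * bar q t η b := by
  rw [bar, bar, coleg_of_eq hab η h, h, pow_succ]
  field_simp

theorem bar_raise_castSucc {m : ℕ} (η : Comp (m + 1)) (i : Fin m) :
    bar q t (raise η) i.castSucc = bar q t η i.succ := by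
  rw [bar, bar, coleg_raise_castSucc, raise_castSucc]

theorem bar_raise_last {m : ℕ} (η : Comp (m + 1)) :
    bar q t (raise η) (Fin.last m) = q * bar q t η 0 := by
  rw [bar, bar, coleg_raise_last, raise_last, pow_succ]
  ring

theorem bar_last_of_eq_zero {m : ℕ} (ν : Comp (m + 1)) (h : ν (Fin.last m) = 0) :
    bar q t ν (Fin.last m) = (t ^ m)⁻¹ := by
  rw [bar, coleg_last_of_eq_zero ν h, h, pow_zero, one_mul]

theorem bar_castSucc_of_eq_zero {m : ℕ} (ν : Comp (m + 1)) (h : ν (Fin.last m) = 0) (i : Fin m) :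
    bar q t ν i.castSucc = bar q t (fun j => ν j.castSucc) i := by
  rw [bar, bar, coleg_castSucc_of_eq_zero ν h]

theorem GenericParams.mul_bar_zero_ne {m : ℕ} (h : GenericParams q t) (η : Comp (m + 1)) :
    q * bar q t η 0 - (t ^ m)⁻¹ ≠ 0 := by
  intro e
  apply h.pow_mul_ne (a := η 0 + 1) (b := 0) (c := coleg η 0) (d := m) (by omega)
  rw [pow_zero, one_mul, ← sub_eq_zero, ← e, bar, pow_succ]
  ring

end Bar

/-! ### Degrees and homogeneous components -/

section LinearSubstitution

variable {K : Type*} [Field K] {σ τ : Type*}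

theorem homogeneousComponent_aeval (φ : σ → MvPolynomial τ K) (hφ : ∀ j, (φ j).IsHomogeneous 1)
    (d : ℕ) (f : MvPolynomial σ K) :
    homogeneousComponent d (aeval φ f) = aeval φ (homogeneousComponent d f) := by
  induction f using MvPolynomial.monomial_add_induction_on with
  | C a =>
    have h := isHomogeneous_C σ a
    have h' := isHomogeneous_C τ a
    rw [homogeneousComponent_of_mem h, aeval_C, MvPolynomial.algebraMap_eq,
      homogeneousComponent_of_mem h']
    split_ifs <;> simp [MvPolynomial.algebraMap_eq]
  | monomial_add m b f _ _ ih =>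
    have h : (monomial m b).IsHomogeneous m.degree := isHomogeneous_monomial b rfl
    have h' := h.aeval φ hφ
    rw [one_mul] at h'
    rw [map_add, map_add, map_add, map_add, ih, homogeneousComponent_of_mem h,
      homogeneousComponent_of_mem h']
    split_ifs <;> simp

theorem totalDegree_aeval_le (φ : σ → MvPolynomial τ K) (hφ : ∀ j, (φ j).IsHomogeneous 1)
    (f : MvPolynomial σ K) : (aeval φ f).totalDegree ≤ f.totalDegree := by
  conv_lhs => rw [← sum_homogeneousComponent f, map_sum]
  apply totalDegree_finsetSum_le
  intro k hk
  have h := ((homogeneousComponent_isHomogeneous k f).aeval φ hφ).totalDegree_le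
  rw [Finset.mem_range] at hk
  omega

theorem homogeneousComponent_X_mul (j : σ) (d : ℕ) (f : MvPolynomial σ K) :
    homogeneousComponent (d + 1) (X j * f) = X j * homogeneousComponent d f := by
  classical
  ext m
  rw [coeff_homogeneousComponent, coeff_X_mul', coeff_X_mul']
  by_cases hj : j ∈ m.support
  · have hm : m = Finsupp.single j 1 + (m - Finsupp.single j 1) := by
      rw [add_tsub_cancel_of_le]
      rw [Finsupp.single_le_iff]
      exact Nat.one_le_iff_ne_zero.2 (Finsupp.mem_support_iff.1 hj)
    have hd : m.degree = (m - Finsupp.single j 1).degree + 1 := by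
      conv_lhs => rw [hm, map_add, Finsupp.degree_single, add_comm]
    simp only [hj, if_true, coeff_homogeneousComponent, hd, Nat.add_right_cancel_iff]
  · simp [hj]

theorem totalDegree_X_mul_le {j : σ} {f : MvPolynomial σ K} {d : ℕ} (h : f.totalDegree ≤ d) :
    (X j * f).totalDegree ≤ d + 1 :=
  (totalDegree_mul _ _).trans (by rw [totalDegree_X]; omega)

theorem totalDegree_C_mul_le {a : K} {f : MvPolynomial σ K} {d : ℕ} (h : f.totalDegree ≤ d) :
    (C a * f).totalDegree ≤ d :=
  (totalDegree_mul _ _).trans (by rw [totalDegree_C]; omega)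

theorem totalDegree_add_le {f g : MvPolynomial σ K} {d : ℕ} (hf : f.totalDegree ≤ d)
    (hg : g.totalDegree ≤ d) : (f + g).totalDegree ≤ d :=
  (totalDegree_add _ _).trans (max_le hf hg)

theorem totalDegree_sub_le' {f g : MvPolynomial σ K} {d : ℕ} (hf : f.totalDegree ≤ d)
    (hg : g.totalDegree ≤ d) : (f - g).totalDegree ≤ d :=
  (totalDegree_sub _ _).trans (max_le hf hg)

theorem totalDegree_le_of_X_mul {j : σ} {f : MvPolynomial σ K} {d : ℕ}
    (h : (X j * f).totalDegree ≤ d + 1) : f.totalDegree ≤ d := by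
  rcases eq_or_ne f 0 with rfl | hf
  · simp
  · rw [totalDegree_mul_of_isDomain (X_ne_zero j) hf, totalDegree_X] at h
    omega

end LinearSubstitution

/-! ### The Hecke operators and their products -/

section Hecke

variable {n : ℕ} [NeZero n] {K : Type*} [Field K] {i : ℕ}

theorem X_sub_X_ne_zero (hi : 1 ≤ i) (hin : i < n) :
    (X (pos n i) - X (pos n (i + 1)) : MvPolynomial (Fin n) K) ≠ 0 :=
  sub_ne_zero.2 fun h => pos_ne_pos_succ hi hin (X_injective h)

/-- The quotient is a chosen witness. Cancellation in a domain makes it unique, and the algebraic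
rules for it follow from this. -/
theorem divDiff_eq (hi : 1 ≤ i) (hin : i < n) {f g : MvPolynomial (Fin n) K}
    (h : (X (pos n i) - X (pos n (i + 1))) * g = swapVars i f - f) : divDiff i f = g :=
  mul_left_cancel₀ (X_sub_X_ne_zero hi hin) ((divDiff_spec i f).trans h.symm)

theorem swapVars_eq (i : ℕ) (f : MvPolynomial (Fin n) K) :
    swapVars i f = f + (X (pos n i) - X (pos n (i + 1))) * divDiff i f := by
  rw [divDiff_spec]
  ring

theorem swapVars_add (i : ℕ) (f g : MvPolynomial (Fin n) K) :
    swapVars i (f + g) = swapVars i f + swapVars i g := map_add _ _ _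

theorem swapVars_mul (i : ℕ) (f g : MvPolynomial (Fin n) K) :
    swapVars i (f * g) = swapVars i f * swapVars i g := map_mul _ _ _

theorem swapVars_C (i : ℕ) (a : K) : swapVars (n := n) i (C a) = C a := rename_C _ _

theorem swapVars_X_left (i : ℕ) :
    swapVars i (X (pos n i) : MvPolynomial (Fin n) K) = X (pos n (i + 1)) := by
  rw [swapVars, rename_X, Equiv.swap_apply_left]

theorem swapVars_X_right (i : ℕ) :
    swapVars i (X (pos n (i + 1)) : MvPolynomial (Fin n) K) = X (pos n i) := by
  rw [swapVars, rename_X, Equiv.swap_apply_right]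

theorem swapVars_swapVars (i : ℕ) (f : MvPolynomial (Fin n) K) :
    swapVars i (swapVars i f) = f := by
  rw [swapVars, swapVars, rename_rename]
  simp [← Equiv.coe_trans]

theorem divDiff_add (hi : 1 ≤ i) (hin : i < n) (f g : MvPolynomial (Fin n) K) :
    divDiff i (f + g) = divDiff i f + divDiff i g :=
  divDiff_eq hi hin (by rw [mul_add, divDiff_spec, divDiff_spec, swapVars_add]; ring)

theorem divDiff_C_mul (hi : 1 ≤ i) (hin : i < n) (a : K) (f : MvPolynomial (Fin n) K) :
    divDiff i (C a * f) = C a * divDiff i f :=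
  divDiff_eq hi hin (by rw [swapVars_mul, swapVars_C, swapVars_eq i f]; ring)

theorem swapVars_divDiff (hi : 1 ≤ i) (hin : i < n) (f : MvPolynomial (Fin n) K) :
    swapVars i (divDiff i f) = divDiff i f := by
  have h := congrArg (swapVars i) (divDiff_spec i f)
  rw [swapVars_mul, sub_eq_add_neg, sub_eq_add_neg, swapVars_add, swapVars_add,
    swapVars_swapVars, swapVars_X_left] at h
  have hneg : ∀ g : MvPolynomial (Fin n) K, swapVars i (-g) = -swapVars i g := fun g => map_neg _ _
  rw [hneg, hneg, swapVars_X_right] at h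
  symm
  exact divDiff_eq hi hin (by linear_combination -h)

theorem divDiff_divDiff (hi : 1 ≤ i) (hin : i < n) (f : MvPolynomial (Fin n) K) :
    divDiff i (divDiff i f) = 0 :=
  divDiff_eq hi hin (by rw [swapVars_divDiff hi hin]; ring)

theorem divDiff_X_left_mul (hi : 1 ≤ i) (hin : i < n) (f : MvPolynomial (Fin n) K) :
    divDiff i (X (pos n i) * f) = X (pos n (i + 1)) * divDiff i f - f :=
  divDiff_eq hi hin (by rw [swapVars_mul, swapVars_X_left, swapVars_eq i f]; ring)

theorem divDiff_X_right_mul (hi : 1 ≤ i) (hin : i < n) (f : MvPolynomial (Fin n) K) :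
    divDiff i (X (pos n (i + 1)) * f) = X (pos n i) * divDiff i f + f :=
  divDiff_eq hi hin (by rw [swapVars_mul, swapVars_X_right, swapVars_eq i f]; ring)

theorem H_C_mul (hi : 1 ≤ i) (hin : i < n) (t a : K) (f : MvPolynomial (Fin n) K) :
    H t i (C a * f) = C a * H t i f := by
  rw [H, H, divDiff_C_mul hi hin]
  ring

theorem divDiff_H (hi : 1 ≤ i) (hin : i < n) (t : K) (f : MvPolynomial (Fin n) K) :
    divDiff i (H t i f) = -divDiff i f := by
  have h : H t i f = C t * f + (X (pos n i) * divDiff i f +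
      C (-t) * (X (pos n (i + 1)) * divDiff i f)) := by
    rw [H, C_neg]
    ring
  rw [h, divDiff_add hi hin, divDiff_add hi hin, divDiff_C_mul hi hin, divDiff_C_mul hi hin,
    divDiff_X_left_mul hi hin, divDiff_X_right_mul hi hin, divDiff_divDiff hi hin, C_neg]
  ring

theorem H_H (hi : 1 ≤ i) (hin : i < n) (t : K) (f : MvPolynomial (Fin n) K) :
    H t i (H t i f) = C (t - 1) * H t i f + C t * f := by
  rw [H, divDiff_H hi hin, H, C_sub, C_1]
  ring

/-- The quadratic relation recovers t f from H f. -/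
theorem H_injective (hi : 1 ≤ i) (hin : i < n) {t : K} (ht : t ≠ 0) :
    Function.Injective (H (n := n) t i) := by
  intro f g h
  have h1 := H_H hi hin t f
  rw [h, H_H hi hin] at h1
  exact mul_left_cancel₀ (C_ne_zero.2 ht) (add_left_cancel h1).symm

theorem H_X_mul_H (hi : 1 ≤ i) (hin : i < n) (t : K) (f : MvPolynomial (Fin n) K) :
    H t i (X (pos n (i + 1)) * H t i f) = C t * (X (pos n i) * f) := by
  rw [H, divDiff_X_right_mul hi hin, divDiff_H hi hin, H]
  ring

theorem H_sub_swapVars (i : ℕ) (t : K) (f : MvPolynomial (Fin n) K) :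
    H t i f - C t * swapVars i f = X (pos n i) * (C (1 - t) * divDiff i f) := by
  rw [H, swapVars_eq, C_sub, C_1]
  ring

/-- With the denominator cleared, H_i involves only multiplications and the exchange of variables.
Its effect on grading, degree and evaluation is read off from this form. -/
theorem X_sub_X_mul_H (i : ℕ) (t : K) (f : MvPolynomial (Fin n) K) :
    X (pos n i) * H t i f - X (pos n (i + 1)) * H t i f =
      X (pos n i) * (C t * f + (swapVars i f - f)) -
        X (pos n (i + 1)) * (C t * f + C t * (swapVars i f - f)) := by
  rw [← divDiff_spec, H]
  ring

theorem homogeneousComponent_swapVars (i d : ℕ) (f : MvPolynomial (Fin n) K) :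
    homogeneousComponent d (swapVars i f) = swapVars i (homogeneousComponent d f) :=
  (rename_homogeneousComponent d f).symm

theorem homogeneousComponent_H (hi : 1 ≤ i) (hin : i < n) (t : K) (d : ℕ)
    (f : MvPolynomial (Fin n) K) :
    homogeneousComponent d (H t i f) = H t i (homogeneousComponent d f) := by
  apply mul_left_cancel₀ (X_sub_X_ne_zero (K := K) hi hin)
  have h := congrArg (homogeneousComponent (d + 1)) (X_sub_X_mul_H i t f)
  rw [map_sub, map_sub, homogeneousComponent_X_mul, homogeneousComponent_X_mul,
    homogeneousComponent_X_mul, homogeneousComponent_X_mul, map_add, map_add, map_sub,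
    homogeneousComponent_C_mul, homogeneousComponent_C_mul, map_sub,
    homogeneousComponent_swapVars, ← X_sub_X_mul_H] at h
  rw [sub_mul, sub_mul, h]

theorem totalDegree_H_le (hi : 1 ≤ i) (hin : i < n) (t : K) {f : MvPolynomial (Fin n) K} {d : ℕ}
    (h : f.totalDegree ≤ d) : (H t i f).totalDegree ≤ d := by
  rcases eq_or_ne (H t i f) 0 with h0 | h0
  · simp [h0]
  have h1 := ((isHomogeneous_X K (pos n i)).sub (isHomogeneous_X K (pos n (i + 1)))).totalDegree
    (X_sub_X_ne_zero hi hin)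
  have h2 := totalDegree_mul_of_isDomain (X_sub_X_ne_zero hi hin) h0
  have h3 : (swapVars i f - f).totalDegree ≤ d :=
    totalDegree_sub_le' ((totalDegree_rename_le _ _).trans h) h
  have h4 : ((X (pos n i) - X (pos n (i + 1))) * H t i f).totalDegree ≤ d + 1 := by
    rw [sub_mul, X_sub_X_mul_H]
    exact totalDegree_sub_le'
      (totalDegree_X_mul_le (totalDegree_add_le (totalDegree_C_mul_le h) h3))
      (totalDegree_X_mul_le
        (totalDegree_add_le (totalDegree_C_mul_le h) (totalDegree_C_mul_le h3)))
  omega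

theorem eval_H {i : ℕ} (t : K) (f : MvPolynomial (Fin n) K) (x : Fin n → K) :
    (x (pos n i) - x (pos n (i + 1))) * eval x (H t i f) =
      t * (x (pos n i) - x (pos n (i + 1))) * eval x f +
        (x (pos n i) - t * x (pos n (i + 1))) *
          (eval (x ∘ Equiv.swap (pos n i) (pos n (i + 1))) f - eval x f) := by
  have h := congrArg (eval x) (X_sub_X_mul_H i t f)
  simp only [map_sub, map_mul, map_add, eval_X, eval_C, swapVars, eval_rename] at h
  linear_combination h

theorem eval_H_of_eq {i : ℕ} (t : K) (f : MvPolynomial (Fin n) K) (x : Fin n → K)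
    (h : x (pos n i) = t * x (pos n (i + 1))) : eval x (H t i f) = t * eval x f := by
  rw [H]
  simp [h]

theorem Tinv_eq_H {t : K} (ht : t ≠ 0) (i : ℕ) (f : MvPolynomial (Fin n) K) :
    Tinv t i f = H t⁻¹ i f := by
  have h : (C t⁻¹ * C t : MvPolynomial (Fin n) K) = 1 := by rw [← C_mul, inv_mul_cancel₀ ht, C_1]
  rw [Tinv, H, T, C_sub, C_1]
  linear_combination (f + X (pos n i) * divDiff i f) * h

theorem T_eq_H {t : K} (ht : t ≠ 0) (i : ℕ) (f : MvPolynomial (Fin n) K) :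
    T t i f = C t * H t⁻¹ i f + C (t - 1) * f := by
  have h : (C t * C t⁻¹ : MvPolynomial (Fin n) K) = 1 := by rw [← C_mul, mul_inv_cancel₀ ht, C_1]
  rw [H, T, C_sub, C_1]
  linear_combination (X (pos n (i + 1)) * divDiff i f - f) * h

/-- The operator `H_1 ⋯ H_m`. -/
noncomputable def descend (t : K) : ℕ → MvPolynomial (Fin n) K → MvPolynomial (Fin n) K
  | 0, f => f
  | m + 1, f => descend t m (H t (m + 1) f)

/-- The operator `H_m ⋯ H_1`. -/
noncomputable def ascend (t : K) : ℕ → MvPolynomial (Fin n) K → MvPolynomial (Fin n) K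
  | 0, f => f
  | m + 1, f => H t (m + 1) (ascend t m f)

theorem foldl_Tinv {t : K} (ht : t ≠ 0) (m : ℕ) (f : MvPolynomial (Fin n) K) :
    (List.range' 1 m).foldl (fun g i => Tinv t i g) f = ascend t⁻¹ m f := by
  induction m with
  | zero => rfl
  | succ m ih =>
    rw [List.range'_concat, List.foldl_append, ih, ascend]
    simp [Tinv_eq_H ht, add_comm]

theorem descend_C_mul (t : K) {m : ℕ} (hm : m < n) (a : K) (f : MvPolynomial (Fin n) K) :
    descend t m (C a * f) = C a * descend t m f := by
  induction m generalizing f with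
  | zero => rfl
  | succ m ih => rw [descend, descend, H_C_mul (by omega) hm, ih (by omega)]

theorem descend_injective {t : K} (ht : t ≠ 0) {m : ℕ} (hm : m < n) :
    Function.Injective (descend (n := n) t m) := by
  induction m with
  | zero => exact fun _ _ h => h
  | succ m ih => exact (ih (by omega)).comp (H_injective (by omega) hm ht)

theorem homogeneousComponent_descend (t : K) {m : ℕ} (hm : m < n) (d : ℕ)
    (f : MvPolynomial (Fin n) K) :
    homogeneousComponent d (descend t m f) = descend t m (homogeneousComponent d f) := by
  induction m generalizing f with
  | zero => rfl
  | succ m ih => rw [descend, descend, ih (by omega), homogeneousComponent_H (by omega) hm]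

theorem totalDegree_descend_le (t : K) {m : ℕ} (hm : m < n) {f : MvPolynomial (Fin n) K} {d : ℕ}
    (h : f.totalDegree ≤ d) : (descend t m f).totalDegree ≤ d := by
  induction m generalizing f with
  | zero => exact h
  | succ m ih => exact ih (by omega) (totalDegree_H_le (by omega) hm t h)

/-- The product telescopes from the inside: each innermost pair H_i z_{i+1} H_i collapses to t z_i.
-/
theorem descend_X_mul_ascend (t : K) {m : ℕ} (hm : m < n) (f : MvPolynomial (Fin n) K) :
    descend t m (X (pos n (m + 1)) * ascend t m f) = C (t ^ m) * (X (pos n 1) * f) := by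
  induction m with
  | zero => simp [descend, ascend]
  | succ m ih =>
    rw [descend, ascend, H_X_mul_H (by omega) hm, descend_C_mul t (by omega), ih (by omega),
      pow_succ, C_mul]
    ring

/-- The permutation of positions underlying `s_1 ⋯ s_m`. -/
def cycle (n : ℕ) [NeZero n] : ℕ → Equiv.Perm (Fin n)
  | 0 => 1
  | m + 1 => cycle n m * Equiv.swap (pos n (m + 1)) (pos n (m + 2))

theorem cycle_apply {m j : ℕ} (hm : m < n) (hj : 1 ≤ j) (hjn : j ≤ n) :
    cycle n m (pos n j) =
      pos n (if j ≤ m then j + 1 else if j = m + 1 then 1 else j) := by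
  induction m generalizing j with
  | zero =>
    rw [cycle, if_neg (by omega)]
    split_ifs with h
    · rw [h]; rfl
    · rfl
  | succ m ih =>
    rw [cycle, Equiv.Perm.mul_apply]
    rcases eq_or_ne j (m + 1) with rfl | h1
    · rw [Equiv.swap_apply_left, ih (by omega) (by omega) (by omega), if_neg (by omega),
        if_neg (by omega), if_pos le_rfl]
    · rcases eq_or_ne j (m + 2) with rfl | h2
      · rw [Equiv.swap_apply_right, ih (by omega) (by omega) (by omega), if_neg (by omega),
          if_pos rfl, if_neg (by omega), if_pos rfl]
      · rw [Equiv.swap_apply_of_ne_of_ne, ih (by omega) hj hjn]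
        · congr 1
          split_ifs <;> omega
        · rwa [Ne, pos_injOn hj hjn (by omega) (by omega)]
        · rwa [Ne, pos_injOn hj hjn (by omega) (by omega)]

/-- Modulo z_i, the operator H_i is t s_i, and s_i turns a congruence modulo z_{i+1} into one modulo
z_i. Iterating, H_1⋯H_m acts modulo z_1 as t^m times a permutation of the variables. -/
theorem dvd_descend_sub (t : K) {m : ℕ} (hm : m < n) (f g : MvPolynomial (Fin n) K)
    (h : X (pos n (m + 1)) ∣ f - g) :
    X (pos n 1) ∣ descend t m f - C (t ^ m) * rename (cycle n m) g := by
  induction m generalizing f g with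
  | zero => simpa [descend, cycle] using h
  | succ m ih =>
    have h1 : X (pos n (m + 1)) ∣ H t (m + 1) f - C t * swapVars (m + 1) g := by
      have h2 : X (pos n (m + 1)) ∣ swapVars (m + 1) f - swapVars (m + 1) g := by
        obtain ⟨k, hk⟩ := h
        refine ⟨swapVars (m + 1) k, ?_⟩
        rw [← swapVars_X_right, ← swapVars_mul, ← hk]
        exact (map_sub _ _ _).symm
      have h3 : X (pos n (m + 1)) ∣ H t (m + 1) f - C t * swapVars (m + 1) f :=
        ⟨_, H_sub_swapVars (m + 1) t f⟩
      have := dvd_add h3 (h2.mul_left (C t))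
      convert this using 1
      ring
    have h4 := ih (by omega) _ _ h1
    rw [descend]
    convert h4 using 2
    rw [map_mul, rename_C, swapVars, rename_rename, pow_succ, C_mul, mul_assoc]
    rfl

end Hecke

/-! ### The raising operator at spectral points and modulo z_1 -/

section RaiseOperator

variable {m : ℕ} {K : Type*} [Field K]

theorem shift_isHomogeneous (q : K) (j : Fin (m + 1)) :
    (if (j : ℕ) = 0 then (C q⁻¹ * X (pos (m + 1) (m + 1)) : MvPolynomial (Fin (m + 1)) K)
      else X (pos (m + 1) (j : ℕ))).IsHomogeneous 1 := by
  split_ifs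
  · exact isHomogeneous_C_mul_X _ _
  · exact isHomogeneous_X _ _

theorem homogeneousComponent_shift (q : K) (d : ℕ) (f : MvPolynomial (Fin (m + 1)) K) :
    homogeneousComponent d (shift q f) = shift q (homogeneousComponent d f) :=
  homogeneousComponent_aeval _ (shift_isHomogeneous q) d f

theorem totalDegree_shift_le (q : K) {f : MvPolynomial (Fin (m + 1)) K} {d : ℕ}
    (h : f.totalDegree ≤ d) : (shift q f).totalDegree ≤ d :=
  (totalDegree_aeval_le _ (shift_isHomogeneous q) f).trans h

theorem raiseI_eq (q t : K) (f : MvPolynomial (Fin (m + 1)) K) :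
    raiseI q t f = X (Fin.last m) * shift q f - C (t ^ m)⁻¹ * shift q f := by
  rw [raiseI, pos_last, sub_mul, Nat.add_sub_cancel]

theorem totalDegree_raiseI_le (q t : K) {f : MvPolynomial (Fin (m + 1)) K} {d : ℕ}
    (h : f.totalDegree ≤ d) : (raiseI q t f).totalDegree ≤ d + 1 := by
  have h1 := totalDegree_shift_le q h
  rw [raiseI_eq]
  exact totalDegree_sub_le' (totalDegree_X_mul_le h1)
    (totalDegree_C_mul_le (h1.trans (Nat.le_succ d)))

/-- Raising rotates the spectral vector and multiplies the entry moved to the end by q, and Δ is the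
substitution that undoes this. -/
theorem eval_bar_raise_shift {q t : K} (hq : q ≠ 0) (μ : Comp (m + 1))
    (f : MvPolynomial (Fin (m + 1)) K) :
    eval (bar q t (raise μ)) (shift q f) = eval (bar q t μ) f := by
  rw [shift, ← coe_aeval_eq_eval, RingHom.coe_coe, comp_aeval_apply, ← coe_aeval_eq_eval,
    RingHom.coe_coe]
  congr 2
  funext j
  refine Fin.cases ?_ (fun j => ?_) j
  · rw [if_pos (by simp), map_mul, aeval_X, pos_last, bar_raise_last, aeval_C,
      Algebra.algebraMap_self, RingHom.id_apply, inv_mul_cancel_left₀ hq]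
  · rw [if_neg (by simp), aeval_X, ← bar_raise_castSucc]
    congr 1
    exact pos_val_succ j.castSucc

theorem eval_bar_raise_raiseI {q t : K} (hq : q ≠ 0) (μ : Comp (m + 1))
    (f : MvPolynomial (Fin (m + 1)) K) :
    eval (bar q t (raise μ)) (raiseI q t f) =
      (q * bar q t μ 0 - (t ^ m)⁻¹) * eval (bar q t μ) f := by
  rw [raiseI_eq, map_sub, map_mul, map_mul, eval_X, eval_C, eval_bar_raise_shift hq,
    bar_raise_last]
  ring

theorem eval_raiseI_of_last_eq_zero {q t : K} (ν : Comp (m + 1)) (h : ν (Fin.last m) = 0)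
    (f : MvPolynomial (Fin (m + 1)) K) : eval (bar q t ν) (raiseI q t f) = 0 := by
  rw [raiseI_eq, map_sub, map_mul, map_mul, eval_X, eval_C, bar_last_of_eq_zero ν h, sub_self]

/-- Modulo z_1, H_1⋯H_m Φ* f becomes t^m (z_1 − t^{-m}) f(z_1/q, z_2, …), which is congruent to −f.
-/
theorem X_dvd_add_descend_raiseI {q t : K} (ht : t ≠ 0) (f : MvPolynomial (Fin (m + 1)) K) :
    X 0 ∣ f + descend t m (raiseI q t f) := by
  set G : MvPolynomial (Fin (m + 1)) K := rename (cycle (m + 1) m) (shift q f) with hG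
  have h1 : X 0 ∣ descend t m (raiseI q t f) -
      C (t ^ m) * rename (cycle (m + 1) m) (raiseI q t f) :=
    dvd_descend_sub t (Nat.lt_succ_self m) _ _ (by simp)
  have h2 : rename (cycle (m + 1) m) (raiseI q t f) = X 0 * G - C (t ^ m)⁻¹ * G := by
    have hc : cycle (m + 1) m (Fin.last m) = 0 := by
      rw [← pos_last, cycle_apply (by omega) (by omega) le_rfl, if_neg (by omega), if_pos rfl,
        pos_one]
    rw [raiseI_eq, map_sub, map_mul, map_mul, rename_X, rename_C, hc]
  have h3 : X 0 ∣ G - f := by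
    -- The cycle undoes the rotation of variables in Δ, leaving only the scaling of z_1.
    have hG' : G = aeval (fun j : Fin (m + 1) => if (j : ℕ) = 0 then
        (C q⁻¹ * X 0 : MvPolynomial (Fin (m + 1)) K) else X j) f := by
      rw [hG, shift, comp_aeval_apply]
      congr 2
      funext j
      split_ifs with hj
      · rw [map_mul, rename_C, rename_X, cycle_apply (by omega) (by omega) le_rfl,
          if_neg (by omega), if_pos rfl, pos_one]
      · rw [rename_X, cycle_apply (by omega) (by omega) (by omega), if_pos (by omega),
          pos_val_succ]
    rw [hG']
    clear_value G
    clear h1 h2 hG hG'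
    induction f using MvPolynomial.induction_on with
    | C a => simp
    | add p r hp hr =>
      rw [map_add]
      convert dvd_add hp hr using 1
      ring
    | mul_X p j hp =>
      have hX : (X 0 : MvPolynomial (Fin (m + 1)) K) ∣
          (if (j : ℕ) = 0 then C q⁻¹ * X 0 else X j) - X j := by
        split_ifs with hj
        · rw [show j = 0 from Fin.ext hj]
          exact ⟨C q⁻¹ - 1, by ring⟩
        · simp
      rw [map_mul, aeval_X]
      convert dvd_add (hp.mul_right (if (j : ℕ) = 0 then C q⁻¹ * X 0 else X j))
        (hX.mul_left p) using 1
      ring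
  have h4 : (C (t ^ m) * C (t ^ m)⁻¹ : MvPolynomial (Fin (m + 1)) K) = 1 := by
    rw [← C_mul, mul_inv_cancel₀ (pow_ne_zero m ht), C_1]
  have h5 : X 0 ∣ X 0 * (C (t ^ m) * G) := dvd_mul_right _ _
  convert (dvd_add h1 h5).sub h3 using 1
  rw [h2]
  linear_combination (-G) * h4

end RaiseOperator

/-! ### Unique interpolation at spectral points -/

section Interpolation

variable {K : Type*} [Field K] {q t : K}

/-- The degree of a composition. -/
def size {n : ℕ} (η : Comp n) : ℕ := ∑ j, η j

theorem size_raise {m : ℕ} (η : Comp (m + 1)) : size (raise η) = size η + 1 := by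
  rw [size, size, Fin.sum_univ_castSucc, Fin.sum_univ_succ]
  simp only [raise_castSucc, raise_last]
  ring

theorem size_comp_perm {n : ℕ} (η : Comp n) (σ : Equiv.Perm (Fin n)) : size (η ∘ σ) = size η :=
  Equiv.sum_comp σ η

theorem raise_injective {m : ℕ} : Function.Injective (raise (n := m + 1)) := by
  intro η ν h
  funext j
  refine Fin.cases ?_ (fun j => ?_) j
  · have := congrFun h (Fin.last m)
    rw [raise_last, raise_last] at this
    omega
  · rw [← raise_castSucc η, h, raise_castSucc]

theorem exists_eq_raise {m : ℕ} (ν : Comp (m + 1)) (h : ν (Fin.last m) ≠ 0) :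
    ∃ μ, ν = raise μ := by
  refine ⟨Fin.cons (ν (Fin.last m) - 1) fun j => ν j.castSucc, ?_⟩
  funext j
  refine Fin.lastCases ?_ (fun j => ?_) j
  · rw [raise_last, Fin.cons_zero]
    omega
  · rw [raise_castSucc, Fin.cons_succ]

/-- Induction on n and d. Compositions with last component 0 are handled by a polynomial in one
variable fewer. Every other composition is Φμ with smaller size, and a correction Φ*k adjusts its
value without disturbing the first kind, because z_n − t^{-n+1} vanishes there. -/
theorem exists_interpolation (h : GenericParams q t) (n d : ℕ) (v : Comp n → K) :
    ∃ f : MvPolynomial (Fin n) K, f.totalDegree ≤ d ∧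
      ∀ ν : Comp n, size ν ≤ d → eval (bar q t ν) f = v ν := by
  induction n generalizing d with
  | zero => exact ⟨C (v 0), by simp, fun ν _ => by rw [Subsingleton.elim ν 0, eval_C]⟩
  | succ m ihm =>
    have boundary : ∀ (d : ℕ) (v : Comp (m + 1) → K),
        ∃ g : MvPolynomial (Fin (m + 1)) K, g.totalDegree ≤ d ∧
          ∀ ν : Comp (m + 1), ν (Fin.last m) = 0 → size ν ≤ d → eval (bar q t ν) g = v ν := by
      intro d v
      obtain ⟨g, hg, hgv⟩ := ihm d fun ν => v (Fin.snoc ν 0)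
      refine ⟨rename Fin.castSucc g, (totalDegree_rename_le _ _).trans hg, fun ν h0 hs => ?_⟩
      have hb : bar q t ν ∘ Fin.castSucc = bar q t fun j : Fin m => ν j.castSucc :=
        funext fun i => bar_castSucc_of_eq_zero ν h0 i
      rw [eval_rename, hb, hgv]
      · congr 1
        rw [← h0]
        exact Fin.snoc_init_self ν
      · rw [size, Fin.sum_univ_castSucc, h0] at hs
        exact hs
    clear ihm
    induction d generalizing v with
    | zero =>
      obtain ⟨g, hg, hgv⟩ := boundary 0 v
      refine ⟨g, hg, fun ν hs => hgv ν ?_ hs⟩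
      have := Finset.single_le_sum (f := ν) (fun j _ => Nat.zero_le _)
        (Finset.mem_univ (Fin.last m))
      rw [size] at hs
      omega
    | succ d ihd =>
      obtain ⟨g, hg, hgv⟩ := boundary (d + 1) v
      -- Applying Φ* multiplies the value of k at μ by q · bar μ_1 − t^{-m} (nonzero by genericity),
      -- so the remaining error is divided by this factor.
      obtain ⟨k, hk, hkv⟩ := ihd fun μ =>
        (v (raise μ) - eval (bar q t (raise μ)) g) / (q * bar q t μ 0 - (t ^ m)⁻¹)
      refine ⟨g + raiseI q t k, totalDegree_add_le hg (totalDegree_raiseI_le q t hk),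
        fun ν hs => ?_⟩
      rw [map_add]
      by_cases h0 : ν (Fin.last m) = 0
      · rw [eval_raiseI_of_last_eq_zero ν h0, hgv ν h0 hs, add_zero]
      · obtain ⟨μ, rfl⟩ := exists_eq_raise ν h0
        rw [size_raise] at hs
        rw [eval_bar_raise_raiseI h.1, hkv μ (by omega),
          mul_div_cancel₀ _ (h.mul_bar_zero_ne μ)]
        ring

theorem finite_size_le (n d : ℕ) : {ν : Comp n | size ν ≤ d}.Finite := by
  apply (Set.finite_Iic (fun _ : Fin n => d)).subset
  intro ν hν j
  exact (Finset.single_le_sum (f := ν) (fun j _ => Nat.zero_le _) (Finset.mem_univ j)).trans hν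

/-- Exponent vectors of monomials of degree at most d are exactly the compositions of size at most
d. Evaluation is thus a surjection between spaces of equal finite dimension, hence injective. -/
theorem eq_zero_of_eval_bar (h : GenericParams q t) {n d : ℕ} {f : MvPolynomial (Fin n) K}
    (hf : f.totalDegree ≤ d) (hv : ∀ ν : Comp n, size ν ≤ d → eval (bar q t ν) f = 0) :
    f = 0 := by
  have hfin : Finite {ν : Comp n | size ν ≤ d} := finite_size_le n d
  let e : {s : Fin n →₀ ℕ | s.degree ≤ d} ≃ {ν : Comp n | size ν ≤ d} :=
    Finsupp.equivFunOnFinite.subtypeEquiv fun s => by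
      simp [size, Finsupp.degree_eq_sum]
  have hfin' : Finite {s : Fin n →₀ ℕ | s.degree ≤ d} := Finite.of_equiv _ e.symm
  let b := (basisRestrictSupport K {s : Fin n →₀ ℕ | s.degree ≤ d}).reindex e
  let L : restrictSupport K {s : Fin n →₀ ℕ | s.degree ≤ d} →ₗ[K]
      ({ν : Comp n | size ν ≤ d} → K) :=
    (LinearMap.pi fun ν => (aeval (bar q t ν.1)).toLinearMap) ∘ₗ Submodule.subtype _
  have hmem : ∀ g : MvPolynomial (Fin n) K,
      g ∈ restrictSupport K {s : Fin n →₀ ℕ | s.degree ≤ d} ↔ g.totalDegree ≤ d :=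
    fun g => mem_restrictTotalDegree _ _ g
  have hsurj : Function.Surjective L := by
    intro v
    obtain ⟨g, hg, hgv⟩ := exists_interpolation h n d fun ν =>
      if hν : size ν ≤ d then v ⟨ν, hν⟩ else 0
    refine ⟨⟨g, (hmem g).2 hg⟩, funext fun ν => ?_⟩
    exact (hgv ν.1 ν.2).trans (dif_pos ν.2)
  have hmf : Module.Finite K (restrictSupport K {s : Fin n →₀ ℕ | s.degree ≤ d}) :=
    Module.Finite.of_basis b
  have hrank : Module.finrank K (restrictSupport K {s : Fin n →₀ ℕ | s.degree ≤ d}) =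
      Module.finrank K ({ν : Comp n | size ν ≤ d} → K) := by
    have := Fintype.ofFinite {ν : Comp n | size ν ≤ d}
    rw [Module.finrank_eq_card_basis b, Module.finrank_fintype_fun_eq_card]
  have hinj := (LinearMap.injective_iff_surjective_of_finrank_eq_finrank hrank).2 hsurj
  have hz : L ⟨f, (hmem f).2 hf⟩ = 0 := funext fun ν => hv ν.1 ν.2
  exact congrArg Subtype.val (hinj (hz.trans (map_zero L).symm))

theorem eq_of_eval_bar (h : GenericParams q t) {n d : ℕ} {f g : MvPolynomial (Fin n) K}
    (hf : f.totalDegree ≤ d) (hg : g.totalDegree ≤ d)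
    (hv : ∀ ν : Comp n, size ν ≤ d → eval (bar q t ν) f = eval (bar q t ν) g) : f = g := by
  rw [← sub_eq_zero]
  exact eq_zero_of_eval_bar h (totalDegree_sub_le' hf hg) fun ν hs => by
    rw [map_sub, hv ν hs, sub_self]

end Interpolation

/-! ### Existence of the interpolation Macdonald polynomials -/

section InterpolationFamily

variable {K : Type*} [Field K] {q t : K} {n : ℕ}

/-- The interpolation Macdonald polynomial, defined by its vanishing property. -/
noncomputable def interpolationPoly (h : GenericParams q t) (η : Comp n) :
    MvPolynomial (Fin n) K :=
  (exists_interpolation h n (size η) (Pi.single η (hookValue q t η))).choose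

theorem totalDegree_interpolationPoly (h : GenericParams q t) (η : Comp n) :
    (interpolationPoly h η).totalDegree ≤ size η :=
  (exists_interpolation h n (size η) (Pi.single η (hookValue q t η))).choose_spec.1

theorem eval_interpolationPoly_self (h : GenericParams q t) (η : Comp n) :
    eval (bar q t η) (interpolationPoly h η) = hookValue q t η :=
  ((exists_interpolation h n (size η) (Pi.single η (hookValue q t η))).choose_spec.2 η
    le_rfl).trans (Pi.single_eq_same _ _)

theorem eval_interpolationPoly_of_ne (h : GenericParams q t) {η ν : Comp n} (hs : size ν ≤ size η)
    (hne : ν ≠ η) : eval (bar q t ν) (interpolationPoly h η) = 0 :=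
  ((exists_interpolation h n (size η) (Pi.single η (hookValue q t η))).choose_spec.2 ν
    hs).trans (Pi.single_eq_of_ne hne _)

theorem interpolationPoly_zero (h : GenericParams q t) :
    interpolationPoly h (0 : Comp n) = 1 := by
  have h0 : size (0 : Comp n) = 0 := by simp [size]
  apply eq_of_eval_bar h (totalDegree_interpolationPoly h 0) (by simp)
  intro ν hs
  have hν : ν = 0 := by
    funext j
    have := Finset.single_le_sum (f := ν) (fun j _ => Nat.zero_le _) (Finset.mem_univ j)
    rw [h0, size] at hs
    rw [Pi.zero_apply]
    omega
  rw [hν, eval_interpolationPoly_self, hookValue_zero, map_one]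

variable [NeZero n] {i : ℕ}

theorem pos_succ_val_eq (hi : 1 ≤ i) (hin : i < n) : (pos n (i + 1) : ℕ) = pos n i + 1 := by
  rw [pos_val hin.le, pos_val (by omega)]
  omega

theorem switch_switch (i : ℕ) (η : Comp n) : switch i (switch i η) = η := by
  funext j
  simp [switch]

theorem switch_left (i : ℕ) (η : Comp n) : switch i η (pos n i) = η (pos n (i + 1)) := by
  simp [switch]

theorem switch_right (i : ℕ) (η : Comp n) : switch i η (pos n (i + 1)) = η (pos n i) := by
  simp [switch]

theorem switch_of_eq {η : Comp n} (h : η (pos n i) = η (pos n (i + 1))) : switch i η = η := by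
  funext j
  rw [switch, Equiv.swap_apply_def]
  split_ifs with h1 h2
  · rw [h1, h]
  · rw [h2, h]
  · rfl

theorem size_switch (i : ℕ) (η : Comp n) : size (switch i η) = size η :=
  size_comp_perm η _

theorem bar_switch (hi : 1 ≤ i) (hin : i < n) (η : Comp n)
    (hne : η (pos n i) ≠ η (pos n (i + 1))) :
    bar q t (switch i η) = bar q t η ∘ Equiv.swap (pos n i) (pos n (i + 1)) :=
  bar_swap (pos_succ_val_eq hi hin) η hne

theorem eval_bar_H_of_eq (h : GenericParams q t) (hi : 1 ≤ i) (hin : i < n) {ν : Comp n}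
    (hν : ν (pos n i) = ν (pos n (i + 1))) (f : MvPolynomial (Fin n) K) :
    eval (bar q t ν) (H t i f) = t * eval (bar q t ν) f :=
  eval_H_of_eq t f _ (bar_of_eq h.2.1 (pos_succ_val_eq hi hin) ν hν)

theorem eval_bar_H_of_ne (hi : 1 ≤ i) (hin : i < n) {ν : Comp n}
    (hν : ν (pos n i) ≠ ν (pos n (i + 1))) (f : MvPolynomial (Fin n) K) :
    (bar q t ν (pos n i) - bar q t ν (pos n (i + 1))) * eval (bar q t ν) (H t i f) =
      t * (bar q t ν (pos n i) - bar q t ν (pos n (i + 1))) * eval (bar q t ν) f +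
        (bar q t ν (pos n i) - t * bar q t ν (pos n (i + 1))) *
          (eval (bar q t (switch i ν)) f - eval (bar q t ν) f) := by
  rw [bar_switch hi hin ν hν]
  exact eval_H t f _

/-- The value of H_i f at the point of ν depends only on the values of f at the points of ν and
s_iν. When ν_i = ν_{i+1} the point of ν alone suffices, since z_i − t z_{i+1} vanishes there. -/
theorem eval_bar_H_eq_zero (h : GenericParams q t) (hi : 1 ≤ i) (hin : i < n) {ν : Comp n}
    {f : MvPolynomial (Fin n) K} (h1 : eval (bar q t ν) f = 0)
    (h2 : eval (bar q t (switch i ν)) f = 0) : eval (bar q t ν) (H t i f) = 0 := by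
  by_cases hν : ν (pos n i) = ν (pos n (i + 1))
  · rw [eval_bar_H_of_eq h hi hin hν, h1, mul_zero]
  · have := eval_bar_H_of_ne hi hin hν (q := q) (t := t) f
    rw [h1, h2, sub_zero, mul_zero, mul_zero, add_zero] at this
    exact (mul_eq_zero.1 this).resolve_left (sub_ne_zero.2 (h.bar_ne_bar hν))

theorem eval_bar_descend_eq_zero (h : GenericParams q t) {m : ℕ} (hm : m < n) {d : ℕ}
    {f : MvPolynomial (Fin n) K} (hf : ∀ ν : Comp n, size ν ≤ d → eval (bar q t ν) f = 0)
    (ν : Comp n) (hν : size ν ≤ d) : eval (bar q t ν) (descend t m f) = 0 := by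
  induction m generalizing f with
  | zero => exact hf ν hν
  | succ m ih =>
    exact ih (by omega) fun μ hμ => eval_bar_H_eq_zero h (by omega) hm (hf μ hμ)
      (hf _ (by rwa [size_switch]))

theorem diagCoeff_eq (h : GenericParams q t) (i : ℕ) (η : Comp n) :
    diagCoeff q t i η = (t - 1) * bar q t η (pos n i) /
      (bar q t η (pos n i) - bar q t η (pos n (i + 1))) := by
  have h1 := h.bar_ne_zero η (pos n i)
  rw [diagCoeff, delta, inv_div, one_sub_div h1, div_div_eq_mul_div]

/-- Both sides have degree at most |η| and vanish at all points of that size except η and s_iη. The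
point η fixes the diagonal coefficient, and the point s_iη imposes the condition `hκ` on κ. -/
theorem H_interpolationPoly_of_ne (h : GenericParams q t) (hi : 1 ≤ i) (hin : i < n) (η : Comp n)
    (hη : η (pos n i) ≠ η (pos n (i + 1))) (κ : K)
    (hκ : κ * hookValue q t (switch i η) *
        (bar q t η (pos n (i + 1)) - bar q t η (pos n i)) =
      (bar q t η (pos n (i + 1)) - t * bar q t η (pos n i)) * hookValue q t η) :
    H t i (interpolationPoly h η) = C (diagCoeff q t i η) * interpolationPoly h η +
      C κ * interpolationPoly h (switch i η) := by
  have hd := totalDegree_interpolationPoly h η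
  have hd' : (interpolationPoly h (switch i η)).totalDegree ≤ size η := by
    have := totalDegree_interpolationPoly h (switch i η)
    rwa [size_switch] at this
  have hne : switch i η ≠ η := fun e => hη (by
    rw [← switch_right i η, e])
  have hsub := sub_ne_zero.2 (h.bar_ne_bar hη)
  apply eq_of_eval_bar h (totalDegree_H_le hi hin t hd)
    (totalDegree_add_le (totalDegree_C_mul_le hd) (totalDegree_C_mul_le hd'))
  intro ν hs
  rw [map_add, map_mul, map_mul, eval_C, eval_C]
  by_cases h1 : ν = η
  · subst h1
    have e := eval_bar_H_of_ne hi hin hη (q := q) (t := t) (interpolationPoly h ν)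
    rw [eval_interpolationPoly_of_ne h (size_switch i ν).le hne] at e
    rw [eval_interpolationPoly_of_ne h (size_switch i ν).ge hne.symm, mul_zero, add_zero,
      diagCoeff_eq h, div_mul_eq_mul_div, eq_div_iff hsub]
    linear_combination e
  · rw [eval_interpolationPoly_of_ne h hs h1, mul_zero, zero_add]
    by_cases h2 : ν = switch i η
    · subst h2
      have hν : switch i η (pos n i) ≠ switch i η (pos n (i + 1)) := by
        rw [switch_left, switch_right]
        exact hη.symm
      have e := eval_bar_H_of_ne hi hin hν (q := q) (t := t) (interpolationPoly h η)
      rw [eval_interpolationPoly_of_ne h hs h1, switch_switch, eval_interpolationPoly_self,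
        bar_switch hi hin η hη] at e
      simp only [Function.comp_apply, Equiv.swap_apply_left, Equiv.swap_apply_right] at e
      rw [eval_interpolationPoly_self]
      rw [bar_switch hi hin η hη]
      apply mul_left_cancel₀ (neg_ne_zero.2 hsub)
      linear_combination e - hκ
    · rw [eval_bar_H_eq_zero h hi hin (eval_interpolationPoly_of_ne h hs h1),
        eval_interpolationPoly_of_ne h (by rwa [size_switch]) h2, mul_zero]
      apply eval_interpolationPoly_of_ne h (by rwa [size_switch])
      intro e
      exact h2 (by rw [← e, switch_switch])

/-- Φ* creates zeros at all points with last component 0 and transports the remaining zeros along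
the injective map Φ. At Φη the constant is that of `hookValue_raise`. -/
theorem raiseI_interpolationPoly {m : ℕ} (h : GenericParams q t) (η : Comp (m + 1)) :
    raiseI q t (interpolationPoly h η) = C (q ^ η 0)⁻¹ * interpolationPoly h (raise η) := by
  have hd := totalDegree_raiseI_le q t (totalDegree_interpolationPoly h η)
  have hd' := totalDegree_interpolationPoly h (raise η)
  rw [size_raise] at hd'
  apply eq_of_eval_bar h hd (totalDegree_C_mul_le hd')
  intro ν hs
  rw [map_mul, eval_C]
  by_cases h0 : ν (Fin.last m) = 0
  · rw [eval_raiseI_of_last_eq_zero ν h0, eval_interpolationPoly_of_ne h (by rwa [size_raise]),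
      mul_zero]
    rintro rfl
    rw [raise_last] at h0
    omega
  · obtain ⟨μ, rfl⟩ := exists_eq_raise ν h0
    rw [eval_bar_raise_raiseI h.1]
    by_cases hμ : μ = η
    · subst hμ
      rw [eval_interpolationPoly_self, eval_interpolationPoly_self, hookValue_raise]
      have := pow_ne_zero (μ 0) h.1
      field_simp
    · rw [eval_interpolationPoly_of_ne h (by rw [size_raise, size_raise] at *; omega)
        (fun e => hμ (raise_injective e)),
        eval_interpolationPoly_of_ne h (by rw [size_raise] at hs; omega) hμ, mul_zero, mul_zero]

theorem isInterpolationMacdonald_interpolationPoly (h : GenericParams q t) :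
    IsInterpolationMacdonald q t (interpolationPoly (n := n) h) where
  init := interpolationPoly_zero h
  switch_lt := by
    intro η i hi hin hlt
    have := H_interpolationPoly_of_ne h hi hin η hlt.ne 1 (by
      rw [one_mul]
      exact hookValue_swap h.2.1 (pos_succ_val_eq hi hin) η hlt)
    rwa [C_1, one_mul] at this
  switch_eq := by
    intro η i hi hin heq
    have hd := totalDegree_interpolationPoly h η
    apply eq_of_eval_bar h (totalDegree_H_le hi hin t hd) (totalDegree_C_mul_le hd)
    intro ν hs
    rw [map_mul, eval_C]
    by_cases hν : ν (pos n i) = ν (pos n (i + 1))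
    · exact eval_bar_H_of_eq h hi hin hν _
    · have h1 : ν ≠ η := fun e => hν (by rw [e, heq])
      have h2 : switch i ν ≠ η := fun e => hν (by
        rw [← switch_right i ν, ← switch_left i ν, e, heq])
      rw [eval_interpolationPoly_of_ne h hs h1, mul_zero]
      exact eval_bar_H_eq_zero h hi hin (eval_interpolationPoly_of_ne h hs h1)
        (eval_interpolationPoly_of_ne h (by rwa [size_switch]) h2)
  switch_gt := by
    intro η i hi hin hgt
    apply H_interpolationPoly_of_ne h hi hin η hgt.ne'
    -- The hook recursion needs increasing components, so it is applied to s_iη and read backwards.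
    have hs := hookValue_swap (q := q) h.2.1 (pos_succ_val_eq hi hin) (switch i η)
      (by rwa [switch_left, switch_right])
    rw [show switch i η ∘ Equiv.swap (pos n i) (pos n (i + 1)) = η from switch_switch i η,
      bar_switch hi hin η hgt.ne'] at hs
    simp only [Function.comp_apply, Equiv.swap_apply_left, Equiv.swap_apply_right] at hs
    have h1 := h.bar_ne_zero η (pos n (i + 1))
    have h2 := sub_ne_zero.2 (h.bar_ne_bar hgt.ne)
    rw [delta]
    generalize bar q t η (pos n i) = x at *
    generalize bar q t η (pos n (i + 1)) = y at *
    have h3 : 1 - x / y = (y - x) / y := by field_simp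
    have h4 : 1 - t * (x / y) = (y - t * x) / y := by field_simp
    have h5 : t - x / y = (t * y - x) / y := by field_simp
    rw [h3, h4, h5]
    field_simp
    linear_combination (y - t * x) * hs
  raise_eq := by
    obtain ⟨m, rfl⟩ := Nat.exists_eq_succ_of_ne_zero (NeZero.ne n)
    exact raiseI_interpolationPoly h

/-- Write the left side as z_1 g, with g of degree at most |η|. The operator term vanishes at every
point of size at most |η|, because Φ*E*_η is a multiple of E*_{Φη}. There z_1 g agrees with E*_η, so
g is a scalar multiple of E*_η by interpolation. -/
theorem add_descend_raiseI_interpolationPoly {m : ℕ} (h : GenericParams q t) (η : Comp (m + 1)) :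
    interpolationPoly h η + descend t m (raiseI q t (interpolationPoly h η)) =
      X 0 * (C (bar q t η 0)⁻¹ * interpolationPoly h η) := by
  obtain ⟨g, hg⟩ := X_dvd_add_descend_raiseI (q := q) h.2.1 (interpolationPoly h η)
  have hd := totalDegree_interpolationPoly h η
  have hgd : g.totalDegree ≤ size η := by
    apply totalDegree_le_of_X_mul (j := 0)
    rw [← hg]
    exact totalDegree_add_le (hd.trans (Nat.le_succ _))
      (totalDegree_descend_le t (Nat.lt_succ_self m) (totalDegree_raiseI_le q t hd))
  rw [hg]
  congr 1
  apply eq_of_eval_bar h hgd (totalDegree_C_mul_le hd)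
  intro ν hs
  have hz : eval (bar q t ν) (descend t m (raiseI q t (interpolationPoly h η))) = 0 := by
    apply eval_bar_descend_eq_zero h (Nat.lt_succ_self m) (d := size η) _ ν hs
    intro μ hμ
    rw [raiseI_interpolationPoly, map_mul, eval_interpolationPoly_of_ne h, mul_zero]
    · rw [size_raise]
      omega
    · rintro rfl
      rw [size_raise] at hμ
      omega
  have e := congrArg (eval (bar q t ν)) hg
  rw [map_add, hz, add_zero, map_mul, eval_X] at e
  rw [map_mul, eval_C]
  by_cases h1 : ν = η
  · subst h1
    rw [e, inv_mul_cancel_left₀ (h.bar_ne_zero _ _)]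
  · rw [eval_interpolationPoly_of_ne h hs h1] at e ⊢
    rw [mul_zero]
    exact (mul_eq_zero.1 e.symm).resolve_left (h.bar_ne_zero _ _)

end InterpolationFamily

/-! ### Top homogeneous parts: the nonsymmetric Macdonald polynomials -/

section NonsymmetricFamily

variable {K : Type*} [Field K] {q t : K} {n : ℕ}

/-- The nonsymmetric Macdonald polynomial, as the leading form of the interpolation polynomial
with inverted parameters. -/
noncomputable def nonsymmetricPoly (h : GenericParams q t) (η : Comp n) :
    MvPolynomial (Fin n) K :=
  homogeneousComponent (size η) (interpolationPoly h.inv η)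

theorem X_mul_shift_nonsymmetricPoly {m : ℕ} (h : GenericParams q t) (η : Comp (m + 1)) :
    X (Fin.last m) * shift q⁻¹ (nonsymmetricPoly h η) =
      homogeneousComponent (size η + 1) (raiseI q⁻¹ t⁻¹ (interpolationPoly h.inv η)) := by
  have hz : homogeneousComponent (size η + 1) (shift q⁻¹ (interpolationPoly h.inv η)) = 0 :=
    homogeneousComponent_eq_zero _ _ (Nat.lt_succ_of_le
      (totalDegree_shift_le _ (totalDegree_interpolationPoly h.inv η)))
  rw [raiseI_eq, map_sub, homogeneousComponent_X_mul, homogeneousComponent_C_mul, hz,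
    homogeneousComponent_shift, mul_zero, sub_zero, nonsymmetricPoly]

theorem raiseE_nonsymmetricPoly {m : ℕ} (h : GenericParams q t) (η : Comp (m + 1)) :
    raiseE t (nonsymmetricPoly h η) =
      C (t ^ firstCount η)⁻¹ * nonsymmetricPoly h (raise η) := by
  have ht' := h.inv.2.1
  have h1 : descend t⁻¹ m (X (Fin.last m) * shift q⁻¹ (nonsymmetricPoly h η)) =
      C (bar q⁻¹ t⁻¹ η 0)⁻¹ * (X 0 * nonsymmetricPoly h η) := by
    have e := congrArg (homogeneousComponent (size η + 1))
      (add_descend_raiseI_interpolationPoly h.inv η)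
    rw [map_add, homogeneousComponent_descend _ (Nat.lt_succ_self m),
      ← X_mul_shift_nonsymmetricPoly h,
      homogeneousComponent_eq_zero _ _ (Nat.lt_succ_of_le (totalDegree_interpolationPoly h.inv η)),
      zero_add, homogeneousComponent_X_mul, homogeneousComponent_C_mul] at e
    rw [e, nonsymmetricPoly]
    ring
  have h2 := descend_X_mul_ascend t⁻¹ (Nat.lt_succ_self m) (nonsymmetricPoly h η)
  rw [pos_last, pos_one] at h2
  -- Both sides have proportional images z_1 E under the injective operator H_1⋯H_m, by `h1` and
  -- `h2`. The scalar is the quotient of the two constants found there.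
  have h3 : X (Fin.last m) * ascend t⁻¹ m (nonsymmetricPoly h η) =
      C (t⁻¹ ^ m * bar q⁻¹ t⁻¹ η 0) *
        (X (Fin.last m) * shift q⁻¹ (nonsymmetricPoly h η)) := by
    apply descend_injective ht' (Nat.lt_succ_self m)
    rw [h2, descend_C_mul _ (Nat.lt_succ_self m), h1, ← mul_assoc (C _) (C _), ← C_mul,
      mul_inv_cancel_right₀ (h.inv.bar_ne_zero _ _)]
  have h4 : t⁻¹ ^ m * bar q⁻¹ t⁻¹ η 0 * (q⁻¹ ^ η 0)⁻¹ = (t ^ firstCount η)⁻¹ := by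
    have hm : t⁻¹ ^ m = t⁻¹ ^ firstCount η * t⁻¹ ^ coleg η 0 := by
      rw [← pow_add, firstCount_add_coleg η]
    have hq' := pow_ne_zero (η 0) h.inv.1
    have ht'' := pow_ne_zero (coleg η 0) ht'
    rw [hm, bar, ← inv_pow t]
    generalize t⁻¹ ^ coleg η 0 = x at *
    generalize q⁻¹ ^ η 0 = y at *
    field_simp
  rw [raiseE, foldl_Tinv h.2.1, Nat.add_sub_cancel, pos_last, h3, X_mul_shift_nonsymmetricPoly,
    raiseI_interpolationPoly, homogeneousComponent_C_mul, ← mul_assoc, ← C_mul, h4,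
    nonsymmetricPoly, size_raise]

variable [NeZero n] {i : ℕ}

theorem T_nonsymmetricPoly (h : GenericParams q t) (hi : 1 ≤ i) (hin : i < n) (η : Comp n)
    {a κ : K} (e : H t⁻¹ i (interpolationPoly h.inv η) =
      C a * interpolationPoly h.inv η + C κ * interpolationPoly h.inv (switch i η)) :
    T t i (nonsymmetricPoly h η) = C (t * a + (t - 1)) * nonsymmetricPoly h η +
      C (t * κ) * nonsymmetricPoly h (switch i η) := by
  have e' := congrArg (homogeneousComponent (size η)) e
  rw [homogeneousComponent_H hi hin, map_add, homogeneousComponent_C_mul,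
    homogeneousComponent_C_mul] at e'
  rw [T_eq_H h.2.1, nonsymmetricPoly, e', nonsymmetricPoly, size_switch, C_add, C_mul, C_mul]
  ring

theorem delta_inv (q t : K) (i : ℕ) (η : Comp n) : delta q⁻¹ t⁻¹ i η = (delta q t i η)⁻¹ := by
  have hbar : ∀ j, bar q⁻¹ t⁻¹ η j = (bar q t η j)⁻¹ := fun j => by
    rw [bar, bar, mul_inv, inv_pow, inv_pow]
  rw [delta, delta, hbar, hbar, inv_div_inv, inv_div]

theorem GenericParams.delta_ne_zero (h : GenericParams q t) (i : ℕ) (η : Comp n) :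
    delta q t i η ≠ 0 := div_ne_zero (h.bar_ne_zero _ _) (h.bar_ne_zero _ _)

theorem GenericParams.delta_ne_one (h : GenericParams q t) {η : Comp n}
    (hη : η (pos n i) ≠ η (pos n (i + 1))) : 1 - delta q t i η ≠ 0 := by
  rw [delta, sub_ne_zero, ne_comm, Ne, div_eq_one_iff_eq (h.bar_ne_zero _ _)]
  exact h.bar_ne_bar hη

theorem GenericParams.mul_delta_ne_one (h : GenericParams q t) {η : Comp n}
    (hη : η (pos n i) ≠ η (pos n (i + 1))) : 1 - t * delta q t i η ≠ 0 := by
  rw [delta, sub_ne_zero, ne_comm, ← mul_div_assoc, Ne, div_eq_one_iff_eq (h.bar_ne_zero _ _)]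
  exact h.mul_bar_ne_bar hη

theorem GenericParams.delta_ne (h : GenericParams q t) {η : Comp n}
    (hη : η (pos n i) ≠ η (pos n (i + 1))) : t - delta q t i η ≠ 0 := by
  rw [delta, sub_ne_zero, Ne, eq_div_iff (h.bar_ne_zero _ _)]
  exact h.mul_bar_ne_bar hη.symm

theorem GenericParams.inv_mul_delta_ne_one (h : GenericParams q t) {η : Comp n}
    (hη : η (pos n i) ≠ η (pos n (i + 1))) : 1 - t⁻¹ * delta q t i η ≠ 0 := by
  have ht := h.2.1
  have := mul_ne_zero (inv_ne_zero ht) (h.delta_ne hη)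
  rwa [mul_sub, inv_mul_cancel₀ ht] at this

/-- Inverting q and t inverts δ; the extra t − 1 comes from T_i = t H_i(t⁻¹) + t − 1. -/
theorem diagCoeff_inv (h : GenericParams q t) {η : Comp n}
    (hη : η (pos n i) ≠ η (pos n (i + 1))) :
    t * diagCoeff q⁻¹ t⁻¹ i η + (t - 1) = diagCoeff q t i η := by
  have ht := h.2.1
  have h1 := h.delta_ne_one hη
  have h2 := h.delta_ne_zero i η
  rw [diagCoeff, diagCoeff, delta_inv, inv_inv]
  have h3 : 1 - (delta q t i η)⁻¹ = -(1 - delta q t i η) / delta q t i η := by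
    field_simp
    ring
  rw [h3]
  field_simp
  ring

theorem isNonsymmetricMacdonald_nonsymmetricPoly (h : GenericParams q t) :
    IsNonsymmetricMacdonald q t (nonsymmetricPoly (n := n) h) where
  init := by
    have h0 : size (0 : Comp n) = 0 := by simp [size]
    rw [nonsymmetricPoly, interpolationPoly_zero, h0,
      homogeneousComponent_eq_self (isHomogeneous_one (Fin n) K)]
  switch_lt := by
    intro η i hi hin hlt
    have e := (isInterpolationMacdonald_interpolationPoly (n := n) h.inv).switch_lt η i hi hin hlt
    rw [T_nonsymmetricPoly h hi hin η (a := diagCoeff q⁻¹ t⁻¹ i η) (κ := 1)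
      (e.trans (by rw [C_1, one_mul])), diagCoeff_inv h hlt.ne, mul_one]
  switch_eq := by
    intro η i hi hin heq
    have e := (isInterpolationMacdonald_interpolationPoly (n := n) h.inv).switch_eq η i hi hin heq
    rw [T_nonsymmetricPoly h hi hin η (a := t⁻¹) (κ := 0)
      (e.trans (by rw [C_0, zero_mul, add_zero])), mul_inv_cancel₀ h.2.1, mul_zero, C_0, zero_mul,
      add_zero, add_sub_cancel]
  switch_gt := by
    intro η i hi hin hgt
    have e := (isInterpolationMacdonald_interpolationPoly (n := n) h.inv).switch_gt η i hi hin hgt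
    rw [T_nonsymmetricPoly h hi hin η e, diagCoeff_inv h hgt.ne', delta_inv]
    congr 3
    have ht := h.2.1
    have h1 := h.delta_ne_one hgt.ne'
    have h2 := h.delta_ne_zero i η
    generalize delta q t i η = x at *
    have h3 : 1 - x⁻¹ = -(1 - x) / x := by
      field_simp
      ring
    rw [h3]
    field_simp
    ring
  raise_eq := by
    obtain ⟨m, rfl⟩ := Nat.exists_eq_succ_of_ne_zero (NeZero.ne n)
    exact raiseE_nonsymmetricPoly h

end NonsymmetricFamily

/-! ### The explicit formulas and uniqueness -/

section Recursion

variable {K : Type*} [Field K] {q t : K} {n : ℕ} [NeZero n] {i : ℕ}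

theorem IsNonsymmetricMacdonald.switchFormulaE_eq (h : GenericParams q t)
    {E : Comp n → MvPolynomial (Fin n) K} (hE : IsNonsymmetricMacdonald q t E) (ν : Comp n)
    (i : ℕ) (hi : 1 ≤ i) (hin : i < n) : switchFormulaE q t i ν (E ν) = E (switch i ν) := by
  rw [switchFormulaE]
  split_ifs with h1 h2
  · have hc : (C t⁻¹ * C t : MvPolynomial (Fin n) K) = 1 := by
      rw [← C_mul, inv_mul_cancel₀ h.2.1, C_1]
    rw [hE.switch_lt ν i hi hin h1, C_mul]
    linear_combination E (switch i ν) * hc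
  · rw [switch_of_eq h2]
  · have hgt : ν (pos n (i + 1)) < ν (pos n i) := by omega
    rw [hE.switch_gt ν i hi hin hgt, add_sub_cancel_left, ← mul_assoc, ← C_mul,
      div_mul_div_cancel₀ (mul_ne_zero (h.mul_delta_ne_one h2) (h.inv_mul_delta_ne_one h2)),
      div_self (pow_ne_zero 2 (h.delta_ne_one h2)), C_1, one_mul]

theorem IsNonsymmetricMacdonald.raiseFormulaE_eq (h : GenericParams q t)
    {E : Comp n → MvPolynomial (Fin n) K} (hE : IsNonsymmetricMacdonald q t E) (ν : Comp n) :
    raiseFormulaE t ν (E ν) = E (raise ν) := by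
  rw [raiseFormulaE, hE.raise_eq, ← mul_assoc, ← C_mul,
    mul_inv_cancel₀ (pow_ne_zero _ h.2.1), C_1, one_mul]

theorem IsInterpolationMacdonald.switchFormulaI_eq (h : GenericParams q t)
    {E : Comp n → MvPolynomial (Fin n) K} (hE : IsInterpolationMacdonald q t E) (ν : Comp n)
    (i : ℕ) (hi : 1 ≤ i) (hin : i < n) : switchFormulaI q t i ν (E ν) = E (switch i ν) := by
  rw [switchFormulaI]
  split_ifs with h1 h2
  · rw [hE.switch_lt ν i hi hin h1, add_sub_cancel_left]
  · rw [switch_of_eq h2]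
  · have hgt : ν (pos n (i + 1)) < ν (pos n i) := by omega
    rw [hE.switch_gt ν i hi hin hgt, add_sub_cancel_left, ← mul_assoc, ← C_mul,
      div_mul_div_cancel₀ (mul_ne_zero (h.mul_delta_ne_one h2) (h.delta_ne h2)),
      div_self (pow_ne_zero 2 (h.delta_ne_one h2)), C_1, one_mul]

theorem IsInterpolationMacdonald.raiseFormulaI_eq (h : GenericParams q t)
    {E : Comp n → MvPolynomial (Fin n) K} (hE : IsInterpolationMacdonald q t E) (ν : Comp n) :
    raiseFormulaI q t ν (E ν) = E (raise ν) := by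
  rw [raiseFormulaI, hE.raise_eq, ← mul_assoc, ← C_mul,
    mul_inv_cancel₀ (pow_ne_zero _ h.1), C_1, one_mul]

theorem IsNonsymmetricMacdonald.RG_eq (h : GenericParams q t)
    {E : Comp n → MvPolynomial (Fin n) K} (hE : IsNonsymmetricMacdonald q t E) (η : Comp n) :
    (∀ j ≤ (word η).length,
      RG (switchFormulaE q t) (raiseFormulaE t) η j = (E (stage η j), stage η j)) ∧
      RG (switchFormulaE q t) (raiseFormulaE t) η (word η).length = (E η, η) :=
  RecGen.RG_eq E _ _ hE.init (hE.switchFormulaE_eq h) (hE.raiseFormulaE_eq h) η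

theorem IsInterpolationMacdonald.RG_eq (h : GenericParams q t)
    {E : Comp n → MvPolynomial (Fin n) K} (hE : IsInterpolationMacdonald q t E) (η : Comp n) :
    (∀ j ≤ (word η).length,
      RG (switchFormulaI q t) (raiseFormulaI q t) η j = (E (stage η j), stage η j)) ∧
      RG (switchFormulaI q t) (raiseFormulaI q t) η (word η).length = (E η, η) :=
  RecGen.RG_eq E _ _ hE.init (hE.switchFormulaI_eq h) (hE.raiseFormulaI_eq h) η

/-- Uniqueness needs no further argument: the output of the recursion does not mention the family,
yet equals its member at η. -/
theorem existsUnique_isNonsymmetricMacdonald (n : ℕ) [NeZero n] (h : GenericParams q t) :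
    ∃! E : Comp n → MvPolynomial (Fin n) K, IsNonsymmetricMacdonald q t E := by
  refine ⟨_, isNonsymmetricMacdonald_nonsymmetricPoly h, fun E hE => funext fun η => ?_⟩
  have e := (hE.RG_eq h η).2.symm.trans
    ((isNonsymmetricMacdonald_nonsymmetricPoly h).RG_eq h η).2
  exact congrArg Prod.fst e

theorem existsUnique_isInterpolationMacdonald (n : ℕ) [NeZero n] (h : GenericParams q t) :
    ∃! E : Comp n → MvPolynomial (Fin n) K, IsInterpolationMacdonald q t E := by
  refine ⟨_, isInterpolationMacdonald_interpolationPoly h, fun E hE => funext fun η => ?_⟩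
  have e := (hE.RG_eq h η).2.symm.trans
    ((isInterpolationMacdonald_interpolationPoly h).RG_eq h η).2
  exact congrArg Prod.fst e

end Recursion

end RecGen

open RecGen in
theorem proposition2 (n : ℕ) [NeZero n] (K : Type*) [Field K] :
    -- every letter of `R(η)` is one of `0, 1, …, n - 1`, and `R(η)` leads to `η`
    (∀ η : Comp n, (∀ a ∈ word η, a < n) ∧ stage η (word η).length = η) ∧
    -- any family `F` with known switching-type and raising-type formulas
    (∀ (F : Comp n → MvPolynomial (Fin n) K)
      (sw : ℕ → Comp n → MvPolynomial (Fin n) K → MvPolynomial (Fin n) K)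
      (ra : Comp n → MvPolynomial (Fin n) K → MvPolynomial (Fin n) K),
      F 0 = 1 →
      (∀ (ν : Comp n) (i : ℕ), 1 ≤ i → i < n → sw i ν (F ν) = F (switch i ν)) →
      (∀ ν : Comp n, ra ν (F ν) = F (raise ν)) →
      ∀ η : Comp n,
        (∀ j ≤ (word η).length, RG sw ra η j = (F (stage η j), stage η j)) ∧
        RG sw ra η (word η).length = (F η, η)) ∧
    ∀ q t : K, GenericParams q t →
      -- the nonsymmetric Macdonald polynomials
      ((∃! E : Comp n → MvPolynomial (Fin n) K, IsNonsymmetricMacdonald q t E) ∧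
        ∀ E : Comp n → MvPolynomial (Fin n) K, IsNonsymmetricMacdonald q t E → ∀ η : Comp n,
          (∀ j ≤ (word η).length,
            RG (switchFormulaE q t) (raiseFormulaE t) η j = (E (stage η j), stage η j)) ∧
          RG (switchFormulaE q t) (raiseFormulaE t) η (word η).length = (E η, η)) ∧
      -- the interpolation Macdonald polynomials
      ((∃! E : Comp n → MvPolynomial (Fin n) K, IsInterpolationMacdonald q t E) ∧
        ∀ E : Comp n → MvPolynomial (Fin n) K, IsInterpolationMacdonald q t E → ∀ η : Comp n,
          (∀ j ≤ (word η).length,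
            RG (switchFormulaI q t) (raiseFormulaI q t) η j = (E (stage η j), stage η j)) ∧
          RG (switchFormulaI q t) (raiseFormulaI q t) η (word η).length = (E η, η)) := by
  refine ⟨fun η => ⟨word_lt η, stage_length η⟩,
    fun F sw ra h0 hsw hra η => RG_eq F sw ra h0 hsw hra η,
    fun q t h => ⟨⟨existsUnique_isNonsymmetricMacdonald n h, fun E hE η => hE.RG_eq h η⟩,
      existsUnique_isInterpolationMacdonald n h, fun E hE η => hE.RG_eq h η⟩⟩
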